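/- **Setting.** Let $\mathcal O,\mathcal A,\mathcal S$ be finite sets (observations, actions, agent states), $H\ge 1$ an integer, $\mu$ a probability distribution on $\mathcal O$, $p_t(\cdot\mid o_{1:t},a_{1:t})$ ($1\le t\le H-1$) transition kernels from histories to probability distributions on $\mathcal O$, and $r_t(o_{1:t},a_{1:t})$ ($1\le t\le H$) reward functions with $|r_t|\le r_{\max}$ for a constant $r_{\max}>0$. Fix a dummy pair $(s_0,a_0)\in\mathcal S\times\mathcal A$. For $\theta\in\mathbb R^d$ and $1\le t\le H$ let $\pi_{\theta,t}(\cdot\mid\tilde s,\tilde a,o)$ be a probability distribution on $\mathcal S\times\mathcal A$ for all $(\tilde s,\tilde a,o)\in\mathcal S\times\mathcal A\times\mathcal O$ (the joint law of the new agent state and action; for instance a product $\nu_{\theta,t}(s\mid\tilde s,\tilde a,o)\,\phi_{\theta,t}(a\mid s)$). Playing $\pi_\theta$ for one episode produces a trajectory $\tau=(o_{1:H},s_{1:H},a_{1:H})$ with probability $$\mathbb P_\theta(\tau)=\mu(o_1)\prod_{t=1}^{H-1}p_t(o_{t+1}\mid o_{1:t},a_{1:t})\prod_{t=1}^{H}\pi_{\theta,t}(s_t,a_t\mid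 s_{t-1},a_{t-1},o_t).$$ Let $J(\theta)=\sum_\tau \mathbb P_\theta(\tau)\sum_{t=1}^H r_t(o_{1:t},a_{1:t})$. **Assumptions.** Every $\pi_{\theta,t}(s,a\mid\tilde s,\tilde a,o)$ is differentiable in $\theta$, and whether it is positive does not depend on $\theta$. There are constants $G,M>0$ such that, for all $t,\theta$ and all $(s,a,\tilde s,\tilde a,o)$ for which it is positive, $\log\pi_{\theta,t}(s,a\mid\tilde s,\tilde a,o)$ is twice differentiable in $\theta$ with $\|\nabla_\theta\log\pi_{\theta,t}(s,a\mid\tilde s,\tilde a,o)\|_2\le G$ and $\|\nabla^2_\theta\log\pi_{\theta,t}(s,a\mid\tilde s,\tilde a,o)\|_2\le M$ (spectral norm). **Algorithm.** Given a deterministic $\theta_1\in\mathbb R^d$ and deterministic stepsizes $\alpha_1,\alpha_2,\dots$, for $k=1,2,\dots$ a trajectory $\tau_k=(o^k_{1:H},s^k_{1:H},a^k_{1:H})$ is drawn whose conditional law given $\tau_1,\dots,\tau_{k-1}$ is $\mathbb P_{\theta_k}$, and $\theta_{k+1}=\theta_k+\alpha_k\widehat g_k$ with (where $s_0^k=s_0$,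 $a_0^k=a_0$) $$\widehat g_k=\sum_{t=1}^H\Big(\sum_{\ell=t}^H r_\ell(o^k_{1:\ell},a^k_{1:\ell})\Big)\nabla_\theta\log\pi_{\theta_k,t}(s^k_t,a^k_t\mid s^k_{t-1},a^k_{t-1},o^k_t).$$ **Theorem.** Let $$\Delta_1=\sup_{\theta\in\mathbb R^d}J(\theta)-J(\theta_1),\qquad \beta=\frac{r_{\max}H(H+1)}{6}\big(3M+G^2(2H+1)\big),\qquad C_H=r_{\max}GH(H+1).$$ Then $J$ is bounded above and differentiable, and the following hold. (a) Let $K\ge1$. If $\alpha_k=\min\Big\{\frac1\beta,\frac{2}{C_H}\sqrt{\frac{2\Delta_1}{\beta K}}\Big\}$ for $k=1,\dots,K$, then $$\frac1K\sum_{k=1}^K\mathbb E\big[\|\nabla J(\theta_k)\|_2^2\big]\le\frac{2\beta\Delta_1}{K}+C_H\sqrt{\frac{\beta\Delta_1}{2K}}.$$ (b) Let $K\ge1$ and $\delta\in(0,1)$. (i) If $\alpha_k=\min\Big\{\frac1\beta,\frac1{C_H}\sqrt{\frac{\Delta_1}{\beta K}}\Big\}$ for $k=1,\dots,K$, then with probability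 at least $1-\delta$ $$\frac1K\sum_{k=1}^K\|\nabla J(\theta_k)\|_2^2\le\frac{2\beta\Delta_1}{K}+5C_H\sqrt{\frac{\beta\Delta_1}{K}}+\frac{12C_H^2\log(1/\delta)}{K}.$$ (ii) If $\alpha_k=\frac1{\beta\sqrt k}$ for $k=1,\dots,K$, then with probability at least $1-\delta$ $$\frac1K\sum_{k=1}^K\|\nabla J(\theta_k)\|_2^2\le\frac{2\beta\Delta_1+3C_H^2(1+\log K)+12C_H^2\log(1/\delta)}{\sqrt K}.$$ (c) If $\alpha_k>0$ for all $k$, $\sum_{k}\alpha_k=\infty$ and $\sum_k\alpha_k^2<\infty$, then $\|\nabla J(\theta_k)\|_2\to0$ almost surely. -/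

import Mathlib

open MeasureTheory ProbabilityTheory Filter Topology

noncomputable section

namespace ASMPG

/-- An episodic non-Markovian decision process with finite observation space `O`, finite action
space `A` and horizon `H`. The index `t : Fin H` stands for the time step `t + 1`, so that histories
of length `t` are the ones available *before* the observation of that step.

* `obsLaw t o a` is the law of the observation at step `t + 1` given the `t` previous observations
  `o` and actions `a`. For `t = 0` both histories are empty and this is the law `μ` of the initial
  observation; for `t ≥ 1` it is the transition kernel `p_t(· ∣ o_{1:t}, a_{1:t})`.
* `reward t o a` is the reward `r_{t+1}(o_{1:t+1}, a_{1:t+1})`. -/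
structure EpisodicNMDP (O A : Type*) [Fintype O] (H : ℕ) where
  obsLaw : (t : Fin H) → (Fin t → O) → (Fin t → A) → stdSimplex ℝ O
  reward : (t : Fin H) → (Fin (t + 1) → O) → (Fin (t + 1) → A) → ℝ

/-- The trajectory `(o_{1:H}, s_{1:H}, a_{1:H})` of one episode. The dummy pair `(s_0, a_0)` is fixed
and hence not recorded. -/
abbrev Traj (O S A : Type*) (H : ℕ) : Type _ := (Fin H → O) × (Fin H → S) × (Fin H → A)

/-- A parametrized family of agent-state policies, `θ ∈ ℝ^d`, given by the combined kernels:
`π θ t s' a' o (s, a)` is the conditional probability `π_{θ,t+1}(s, a ∣ s', a', o)` of the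
new agent state and action `(s, a)` given the previous agent state `s'`, the previous action `a'`
and the current observation `o`. Products `ν_{θ,t}(s ∣ s', a', o) φ_{θ,t}(a ∣ s)` of an agent state update
and a control policy are a special case. -/
abbrev PolicyFamily (d : ℕ) (O S A : Type*) [Fintype S] [Fintype A] (H : ℕ) : Type _ :=
  EuclideanSpace ℝ (Fin d) → Fin H → S → A → O → stdSimplex ℝ (S × A)

section Objects

variable {O S A : Type*} [Fintype O] [Fintype S] [Fintype A] {H d : ℕ}

/-- The first `n` entries of a sequence of length `H`. -/
def upTo {X : Type*} (x : Fin H → X) (n : ℕ) (hn : n ≤ H) : Fin n → X :=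
  fun i => x (Fin.castLE hn i)

/-- The entry at the step preceding `t`, where `x₀` is the entry at time zero. -/
def prev {X : Type*} (x₀ : X) (x : Fin H → X) (t : Fin H) : X :=
  Matrix.vecCons x₀ x t.castSucc

/-- The reward received at step `t` along a trajectory. -/
def rewardAt (E : EpisodicNMDP O A H) (τ : Traj O S A H) (t : Fin H) : ℝ :=
  E.reward t (upTo τ.1 (t + 1) t.isLt) (upTo τ.2.2 (t + 1) t.isLt)

/-- The reward-to-go `R_{t:H}` of a trajectory. -/
def rewardToGo (E : EpisodicNMDP O A H) (τ : Traj O S A H) (t : Fin H) : ℝ :=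
  ∑ l ∈ Finset.univ.filter (fun l : Fin H => t ≤ l), rewardAt E τ l

/-- The total return `R_{1:H}` of a trajectory. -/
def totalReturn (E : EpisodicNMDP O A H) (τ : Traj O S A H) : ℝ :=
  ∑ t : Fin H, rewardAt E τ t

/-- The probability of the trajectory `τ` when `π_θ` is played for one episode from `(s₀, a₀)`. -/
def trajProb (E : EpisodicNMDP O A H) (π : PolicyFamily d O S A H) (s₀ : S) (a₀ : A)
    (θ : EuclideanSpace ℝ (Fin d)) (τ : Traj O S A H) : ℝ :=
  ∏ t : Fin H,
    (E.obsLaw t (upTo τ.1 t t.isLt.le) (upTo τ.2.2 t t.isLt.le)).1 (τ.1 t) *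
      (π θ t (prev s₀ τ.2.1 t) (prev a₀ τ.2.2 t) (τ.1 t)).1 (τ.2.1 t, τ.2.2 t)

/-- The objective `J(θ)`: the expected return of one episode under `π_θ`. -/
def objective (E : EpisodicNMDP O A H) (π : PolicyFamily d O S A H) (s₀ : S) (a₀ : A)
    (θ : EuclideanSpace ℝ (Fin d)) : ℝ :=
  ∑ τ : Traj O S A H, trajProb E π s₀ a₀ θ τ * totalReturn E τ

/-- The score `∇_θ log π_{θ,t}(s, a ∣ s', a', o)`. -/
def score (π : PolicyFamily d O S A H) (t : Fin H) (s' : S) (a' : A) (o : O) (s : S) (a : A)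
    (θ : EuclideanSpace ℝ (Fin d)) : EuclideanSpace ℝ (Fin d) :=
  gradient (fun η => Real.log ((π η t s' a' o).1 (s, a))) θ

/-- The stochastic gradient computed from the trajectory `τ` of one episode played with `π_θ`. -/
def gradEstimate (E : EpisodicNMDP O A H) (π : PolicyFamily d O S A H) (s₀ : S) (a₀ : A)
    (θ : EuclideanSpace ℝ (Fin d)) (τ : Traj O S A H) : EuclideanSpace ℝ (Fin d) :=
  ∑ t : Fin H, rewardToGo E τ t •
    score π t (prev s₀ τ.2.1 t) (prev a₀ τ.2.2 t) (τ.1 t) (τ.2.1 t) (τ.2.2 t) θ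

/-- The kernels are differentiable in `θ` and their supports do not depend on `θ`. -/
structure IsRegular (π : PolicyFamily d O S A H) : Prop where
  differentiable : ∀ t s' a' o s a, Differentiable ℝ (fun θ => (π θ t s' a' o).1 (s, a))
  support_indep : ∀ t s' a' o s a θ η,
    0 < (π θ t s' a' o).1 (s, a) → 0 < (π η t s' a' o).1 (s, a)

/-- Uniform score and Hessian bounds, for all entries of positive probability (where `log π` is
defined). The Hessian of `log π` is the derivative of the score, a linear map on `ℝ^d`, and its
norm is the operator norm with respect to the Euclidean norm. -/
structure HasScoreHessianBounds (π : PolicyFamily d O S A H) (G M : ℝ) : Prop where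
  score_le : ∀ t s' a' o s a θ, 0 < (π θ t s' a' o).1 (s, a) →
    ‖score π t s' a' o s a θ‖ ≤ G
  differentiable_score : ∀ t s' a' o s a θ, 0 < (π θ t s' a' o).1 (s, a) →
    DifferentiableAt ℝ (score π t s' a' o s a) θ
  hessian_le : ∀ t s' a' o s a θ, 0 < (π θ t s' a' o).1 (s, a) →
    ‖fderiv ℝ (score π t s' a' o s a) θ‖ ≤ M

/-- The σ-algebra generated by the trajectories `T 1, …, T (k - 1)`. -/
abbrev past {Ω : Type*} (T : ℕ → Ω → Traj O S A H) (k : ℕ) : MeasurableSpace Ω :=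
  ⨆ j ∈ Finset.Ico 1 k, MeasurableSpace.comap (T j) ⊤

/-- `θ 1, θ 2, …` are the iterates, and `T 1, T 2, …` the episode trajectories, of a run of the
agent-state policy gradient algorithm with deterministic initial parameter `θ₁` and stepsizes
`α 1, α 2, …`: given the earlier episodes, the `k`-th trajectory is distributed as an episode
played with `π_{θ k}`, and `θ (k + 1) = θ k + α k • ĝ k`. -/
structure IsRun (E : EpisodicNMDP O A H) (π : PolicyFamily d O S A H) (s₀ : S) (a₀ : A)
    {Ω : Type*} [MeasurableSpace Ω] (P : Measure Ω) (θ₁ : EuclideanSpace ℝ (Fin d)) (α : ℕ → ℝ)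
    (T : ℕ → Ω → Traj O S A H) (θ : ℕ → Ω → EuclideanSpace ℝ (Fin d)) : Prop where
  measurable : ∀ k, 1 ≤ k → ∀ τ, MeasurableSet (T k ⁻¹' {τ})
  cond_law : ∀ k, 1 ≤ k → ∀ τ,
    P⟦T k ⁻¹' {τ} | past T k⟧ =ᵐ[P] fun ω => trajProb E π s₀ a₀ (θ k ω) τ
  init : ∀ ω, θ 1 ω = θ₁
  step : ∀ k, 1 ≤ k → ∀ ω, θ (k + 1) ω = θ k ω + α k • gradEstimate E π s₀ a₀ (θ k ω) (T k ω)

/-- The initial gap `Δ₁ = sup_θ J(θ) - J(θ₁)`. -/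
def gap (E : EpisodicNMDP O A H) (π : PolicyFamily d O S A H) (s₀ : S) (a₀ : A)
    (θ₁ : EuclideanSpace ℝ (Fin d)) : ℝ :=
  (⨆ θ, objective E π s₀ a₀ θ) - objective E π s₀ a₀ θ₁

end Objects

/-- `β = r_max H (H + 1) / 6 * (3 M + G² (2 H + 1))`. -/
def smoothConst (rmax G M : ℝ) (H : ℕ) : ℝ :=
  rmax * H * (H + 1) / 6 * (3 * M + G ^ 2 * (2 * H + 1))

/-- `C_H = r_max G H (H + 1)`. -/
def noiseConst (rmax G : ℝ) (H : ℕ) : ℝ :=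
  rmax * G * H * (H + 1)

end ASMPG

end

/-! The argument has two halves: the regularity of `J`, and stochastic ascent for any objective with
that regularity.

Split `J` by the time at which a reward is earned. The reward of step `l` depends on the first `l`
steps only, so its expectation does not change when all later kernels are replaced by uniform laws
(`sum_prod_kernel`, `objective_eq`). Replacing them, instead of dropping them, keeps every law on
the same finite trajectory space. Differentiating the truncated law produces only the scores of the
steps up to `l`; regrouped by score, this is the reward-to-go estimator, which is therefore
unbiased. A law of `l` steps has logarithmic gradient at most `l G` with derivative at most `l M`.
Summing over `l` gives the Lipschitz constant `β` of the gradient and the bound `C / 2` on the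
estimator.

The second half uses only the properties in `IsGradientOracle`. The ascent inequality telescopes
along each path (`sum_inner_le`) and bounds the weighted sum of the inner products of gradient and
estimate. Taking expectations turns these into squared gradient norms, which gives (a). For (b), the
noise in the direction of the gradient has size at most `2 B ‖∇J‖`, so its sub-Gaussian variance
proxy is a multiple of `‖∇J‖²`. With a suitable scale, half of the left-hand side absorbs it, and
Markov's inequality for an exponential supermartingale finishes. For (c), the expectation bound
makes `∑ α_k ‖∇J(θ_k)‖²` almost surely finite; since `‖∇J(θ_k)‖` moves by at most `β B α_k` per
step, it cannot keep returning above a fixed level (`tendsto_zero_of_summable_mul_sq`). -/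

namespace ASMPG

/-! ### Smoothness calculus: ascent inequality and logarithmic gradients -/

section Smooth

variable {V : Type*} [NormedAddCommGroup V] [InnerProductSpace ℝ V] [CompleteSpace V]

/-- The ascent inequality for functions with a Lipschitz gradient. -/
theorem le_of_gradient_lipschitz {f : V → ℝ} {β : ℝ} (hf : Differentiable ℝ f)
    (hl : ∀ x y, ‖gradient f x - gradient f y‖ ≤ β * ‖x - y‖) (x v : V) :
    f x + inner ℝ (gradient f x) v - β / 2 * ‖v‖ ^ 2 ≤ f (x + v) := by
  -- The quadratic correction makes `φ` nondecreasing on `[0, 1]`, so comparing `φ 0` with `φ 1`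
  -- replaces an integral along the segment.
  set φ : ℝ → ℝ := fun s =>
    f (x + s • v) - s * inner ℝ (gradient f x) v + β / 2 * s ^ 2 * ‖v‖ ^ 2 with hφ
  have hd : ∀ s, HasDerivAt φ (inner ℝ (gradient f (x + s • v)) v -
      inner ℝ (gradient f x) v + β * s * ‖v‖ ^ 2) s := by
    intro s
    have h1 : HasDerivAt (fun s : ℝ => x + s • v) v s := by
      simpa using ((hasDerivAt_id s).smul_const v).const_add x
    have h2 := (hf (x + s • v)).hasGradientAt.hasFDerivAt.comp_hasDerivAt s h1
    have h3 := (h2.sub ((hasDerivAt_id s).mul_const (inner ℝ (gradient f x) v))).add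
      ((((hasDerivAt_id s).pow 2).const_mul (β / 2)).mul_const (‖v‖ ^ 2))
    refine h3.congr_deriv ?_
    simp only [InnerProductSpace.toDual_apply_apply, id, Nat.add_one_sub_one, pow_one,
      Nat.cast_ofNat]
    ring
  have hmono : MonotoneOn φ (Set.Icc 0 1) := by
    refine monotoneOn_of_deriv_nonneg (convex_Icc 0 1)
      (fun s _ => (hd s).continuousAt.continuousWithinAt)
      (fun s _ => (hd s).differentiableAt.differentiableWithinAt) ?_
    intro s hs
    rw [interior_Icc] at hs
    rw [(hd s).deriv, ← inner_sub_left]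
    have h1 := neg_le_of_abs_le (abs_real_inner_le_norm (gradient f (x + s • v) - gradient f x) v)
    have h2 := hl (x + s • v) x
    rw [add_sub_cancel_left, norm_smul, Real.norm_of_nonneg hs.1.le] at h2
    have h3 := mul_le_mul_of_nonneg_right h2 (norm_nonneg v)
    nlinarith
  have := hmono (Set.left_mem_Icc.2 zero_le_one) (Set.right_mem_Icc.2 zero_le_one) zero_le_one
  have h0 : φ 0 = f x := by simp [hφ]
  have h1 : φ 1 = f (x + v) - inner ℝ (gradient f x) v + β / 2 * ‖v‖ ^ 2 := by
    simp only [hφ, one_smul]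
    ring
  linarith

/-- `u` is nonnegative with logarithmic gradient `g`, which is bounded by `G` and has derivative
bounded by `M`. Points where `u` vanishes are allowed. -/
structure IsLogSmooth (u : V → ℝ) (g : V → V) (G M : ℝ) : Prop where
  nonneg : ∀ x, 0 ≤ u x
  hasGradientAt : ∀ x, HasGradientAt u (u x • g x) x
  norm_le : ∀ x, ‖g x‖ ≤ G
  differentiable : Differentiable ℝ g
  norm_fderiv_le : ∀ x, ‖fderiv ℝ g x‖ ≤ M

namespace IsLogSmooth

variable {u u₁ u₂ : V → ℝ} {g g₁ g₂ : V → V} {G G₁ G₂ M M₁ M₂ : ℝ}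

theorem const {c : ℝ} (hc : 0 ≤ c) : IsLogSmooth (fun _ : V => c) (fun _ => 0) 0 0 where
  nonneg _ := hc
  hasGradientAt x := by simpa using hasGradientAt_const x c
  norm_le _ := by simp
  differentiable := differentiable_const _
  norm_fderiv_le _ := by simp

/-- Logarithmic gradients add under products, and so do their bounds. Writing the gradient as `u •
g` avoids dividing by `u`, so zeros cause no trouble. -/
theorem mul (h₁ : IsLogSmooth u₁ g₁ G₁ M₁) (h₂ : IsLogSmooth u₂ g₂ G₂ M₂) :
    IsLogSmooth (fun x => u₁ x * u₂ x) (fun x => g₁ x + g₂ x) (G₁ + G₂) (M₁ + M₂) where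
  nonneg x := mul_nonneg (h₁.nonneg x) (h₂.nonneg x)
  hasGradientAt x := by
    rw [hasGradientAt_iff_hasFDerivAt]
    refine ((h₁.hasGradientAt x).hasFDerivAt.mul (h₂.hasGradientAt x).hasFDerivAt).congr_fderiv ?_
    ext v
    simp
    ring
  norm_le x := (norm_add_le _ _).trans (add_le_add (h₁.norm_le x) (h₂.norm_le x))
  differentiable := h₁.differentiable.add h₂.differentiable
  norm_fderiv_le x := by
    rw [fderiv_fun_add (h₁.differentiable x) (h₂.differentiable x)]
    exact (norm_add_le _ _).trans (add_le_add (h₁.norm_fderiv_le x) (h₂.norm_fderiv_le x))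

theorem const_mul {c : ℝ} (hc : 0 ≤ c) (h : IsLogSmooth u g G M) :
    IsLogSmooth (fun x => c * u x) g G M := by
  simpa using (const hc).mul h

theorem prod {ι : Type*} (s : Finset ι) {u : ι → V → ℝ} {g : ι → V → V} {G M : ι → ℝ}
    (h : ∀ i ∈ s, IsLogSmooth (u i) (g i) (G i) (M i)) :
    IsLogSmooth (fun x => ∏ i ∈ s, u i x) (fun x => ∑ i ∈ s, g i x) (∑ i ∈ s, G i)
      (∑ i ∈ s, M i) := by
  classical
  induction s using Finset.induction_on with
  | empty => simpa using const (V := V) zero_le_one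
  | insert a s ha ih =>
    simp only [Finset.prod_insert ha, Finset.sum_insert ha]
    exact (h a (Finset.mem_insert_self a s)).mul
      (ih fun i hi => h i (Finset.mem_insert_of_mem hi))

theorem differentiable_left (h : IsLogSmooth u g G M) : Differentiable ℝ u :=
  fun x => (h.hasGradientAt x).differentiableAt

theorem differentiable_smul (h : IsLogSmooth u g G M) : Differentiable ℝ (fun x => u x • g x) :=
  h.differentiable_left.smul h.differentiable

/-- The derivative of `u • g`, which is the Hessian of `u`, is `u` times the sum of `g ⊗ g` and the
derivative of `g`. The factor `u x` is kept so that the bound can be averaged over a probability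
law. -/
theorem norm_fderiv_smul_le (h : IsLogSmooth u g G M) (x : V) :
    ‖fderiv ℝ (fun x => u x • g x) x‖ ≤ u x * (G ^ 2 + M) := by
  have hd := (h.hasGradientAt x).hasFDerivAt.smul (h.differentiable x).hasFDerivAt
  rw [HasFDerivAt.fderiv (f := fun x => u x • g x) hd]
  have hu := h.nonneg x
  have hg := h.norm_le x
  have hG := mul_nonneg hu ((norm_nonneg _).trans hg)
  calc _ ≤ ‖u x • fderiv ℝ g x‖ +
        ‖(InnerProductSpace.toDual ℝ V (u x • g x)).smulRight (g x)‖ := norm_add_le _ _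
    _ ≤ u x * M + (u x * G) * G := by
        refine add_le_add ?_ ?_
        · rw [norm_smul, Real.norm_of_nonneg hu]
          exact mul_le_mul_of_nonneg_left (h.norm_fderiv_le x) hu
        · rw [ContinuousLinearMap.norm_smulRight_apply, LinearIsometryEquiv.norm_map, norm_smul,
            Real.norm_of_nonneg hu]
          gcongr
    _ = _ := by ring

end IsLogSmooth

/-- The gradient of an expectation in which the weights, and not the integrand, depend on the
parameter. -/
theorem hasGradientAt_sum_mul {ι : Type*} (s : Finset ι) {u : ι → V → ℝ} {v : ι → V} (r : ι → ℝ)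
    {x : V} (h : ∀ i ∈ s, HasGradientAt (u i) (v i) x) :
    HasGradientAt (fun y => ∑ i ∈ s, u i y * r i) (∑ i ∈ s, r i • v i) x := by
  rw [hasGradientAt_iff_hasFDerivAt]
  refine (HasFDerivAt.fun_sum fun i hi => (h i hi).hasFDerivAt.mul_const (r i)).congr_fderiv ?_
  simp

/-- The bounds are proportional to the weights `u i x`, whose total is one, so the number of terms
does not enter. -/
theorem norm_fderiv_sum_smul_le {ι : Type*} (s : Finset ι) {u : ι → V → ℝ} {g : ι → V → V}
    {G M R : ℝ} {r : ι → ℝ} (h : ∀ i ∈ s, IsLogSmooth (u i) (g i) G M)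
    (hr : ∀ i ∈ s, |r i| ≤ R) {x : V} (hu : ∑ i ∈ s, u i x = 1) :
    ‖fderiv ℝ (fun y => ∑ i ∈ s, r i • (u i y • g i y)) x‖ ≤ R * (G ^ 2 + M) := by
  rw [fderiv_fun_sum fun i hi => ((h i hi).differentiable_smul x).fun_const_smul (r i)]
  refine (norm_sum_le _ _).trans ?_
  calc _ ≤ ∑ i ∈ s, R * (u i x * (G ^ 2 + M)) := by
        refine Finset.sum_le_sum fun i hi => ?_
        rw [fderiv_fun_const_smul ((h i hi).differentiable_smul x), norm_smul, Real.norm_eq_abs]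
        have := (h i hi).norm_fderiv_smul_le x
        exact mul_le_mul (hr i hi) this (norm_nonneg _) ((abs_nonneg _).trans (hr i hi))
    _ = R * (G ^ 2 + M) := by rw [← Finset.mul_sum, ← Finset.sum_mul, hu, one_mul]

end Smooth

/-! ### A deterministic convergence criterion -/

/-- A nonnegative sequence whose increments are controlled by stepsizes that tend to zero and sum
to infinity tends to zero if its squares are summable with respect to the stepsizes. -/
theorem tendsto_zero_of_summable_mul_sq {a x : ℕ → ℝ} {c : ℝ} (hc : 0 < c) (ha : ∀ k, 0 < a k)
    (ha0 : Tendsto a atTop (𝓝 0)) (hdiv : ¬ Summable a) (hx : ∀ k, 0 ≤ x k)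
    (hsum : Summable fun k => a k * x k ^ 2) (hinc : ∀ k, x (k + 1) ≤ x k + c * a k) :
    Tendsto x atTop (𝓝 0) := by
  rw [Metric.tendsto_atTop]
  intro ε' hε'
  obtain ⟨ε, hε, rfl⟩ : ∃ ε, 0 < ε ∧ ε' = 3 * ε := ⟨ε' / 3, by positivity, by ring⟩
  have hη : 0 < ε ^ 3 / (2 * c) := by positivity
  have htail : ∀ᶠ m in atTop, ∑' k, a (k + m) * x (k + m) ^ 2 < ε ^ 3 / (2 * c) :=
    (tendsto_sum_nat_add fun k => a k * x k ^ 2).eventually (gt_mem_nhds hη)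
  have hsmall : ∀ᶠ m in atTop, c * a m < ε / 2 := by
    have : Tendsto (fun m => c * a m) atTop (𝓝 0) := by simpa using ha0.const_mul c
    exact this.eventually (gt_mem_nhds (by positivity))
  obtain ⟨N, hN⟩ := eventually_atTop.1 (htail.and hsmall)
  -- If `x` stayed above `ε`, then `a` would be dominated by `a x² / ε²` and be summable.
  obtain ⟨m, hm, hxm⟩ : ∃ m, N ≤ m ∧ x m < ε := by
    by_contra! hcon
    refine hdiv ?_
    rw [← summable_nat_add_iff N]
    refine Summable.of_nonneg_of_le (fun k => (ha _).le) (fun k => ?_)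
      (((summable_nat_add_iff N).2 hsum).mul_left (1 / ε ^ 2))
    have h1 := hcon (k + N) (by omega)
    have h2 : ε ^ 2 ≤ x (k + N) ^ 2 := by gcongr
    rw [one_div, ← div_eq_inv_mul, le_div_iff₀ (by positivity)]
    exact mul_le_mul_of_nonneg_left h2 (ha _).le
  -- Below `ε`, one step reaches at most `3 / 2 * ε` because `c * a < ε / 2`. Above `ε`, the
  -- increment `c * a` is paid for by the new term of the sum. The tail bound `ε ^ 3 / (2 * c)` was
  -- chosen so that the whole sum contributes at most `ε / 2`.
  have key : ∀ n, x (m + n) ≤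
      3 / 2 * ε + c / ε ^ 2 * ∑ k ∈ Finset.range n, a (k + m) * x (k + m) ^ 2 := by
    intro n
    induction n with
    | zero => simp; linarith
    | succ n ih =>
      rw [Finset.sum_range_succ, ← add_assoc, add_comm n m]
      have h1 := hinc (m + n)
      have h2 : 0 ≤ ∑ k ∈ Finset.range n, a (k + m) * x (k + m) ^ 2 :=
        Finset.sum_nonneg fun k _ => mul_nonneg (ha _).le (sq_nonneg _)
      have h3 := (hN (m + n) (by omega)).2
      have h4 : 0 ≤ c / ε ^ 2 * ∑ k ∈ Finset.range n, a (k + m) * x (k + m) ^ 2 := by positivity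
      have h5 := ha (m + n)
      rcases lt_or_ge (x (m + n)) ε with h | h
      · have : 0 ≤ c / ε ^ 2 * (a (m + n) * x (m + n) ^ 2) := by positivity
        rw [mul_add]
        linarith
      · have : c * a (m + n) ≤ c / ε ^ 2 * (a (m + n) * x (m + n) ^ 2) := by
          have h6 : ε ^ 2 ≤ x (m + n) ^ 2 := by gcongr
          rw [div_mul_eq_mul_div, le_div_iff₀ (by positivity), mul_assoc]
          gcongr
        rw [mul_add]
        linarith
  refine ⟨m, fun n hn => ?_⟩
  rw [Real.dist_eq, sub_zero, abs_of_nonneg (hx n)]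
  obtain ⟨j, rfl⟩ := Nat.exists_eq_add_of_le hn
  have h1 : ∑ k ∈ Finset.range j, a (k + m) * x (k + m) ^ 2 < ε ^ 3 / (2 * c) :=
    (((summable_nat_add_iff m).2 hsum).sum_le_tsum _ fun k _ =>
      mul_nonneg (ha _).le (sq_nonneg _)).trans_lt (hN m hm).1
  have h2 := mul_lt_mul_of_pos_left h1 (show 0 < c / ε ^ 2 by positivity)
  have h3 : c / ε ^ 2 * (ε ^ 3 / (2 * c)) = ε / 2 := by field_simp
  linarith [key j]

/-! ### Integrating out causal kernels -/

section Marginalization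

variable {X : Type*} [Fintype X] {H : ℕ}

/-- Exchanging `x i` with an independent value `z` is an involution of the pairs `(x, z)`. -/
theorem sum_eq_average_update {ι : Type*} [Fintype ι] [DecidableEq ι] [Nonempty X] (h : (ι → X) → ℝ)
    (i : ι) :
    ∑ x, h x = (Fintype.card X : ℝ)⁻¹ * ∑ x, ∑ z, h (Function.update x i z) := by
  let e : (ι → X) × X → (ι → X) × X := fun p => (Function.update p.1 i p.2, p.1 i)
  have he : Function.Involutive e := fun p => by simp [e]
  have h1 : ∑ p : (ι → X) × X, h (Function.update p.1 i p.2) = ∑ p : (ι → X) × X, h p.1 :=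
    Fintype.sum_equiv he.toPerm _ _ fun p => rfl
  rw [Fintype.sum_prod_type, Fintype.sum_prod_type] at h1
  rw [h1]
  simp [← Finset.mul_sum]

/-- A factor depending on coordinate `i` only through a probability kernel may be replaced by the
uniform law on this coordinate. -/
theorem sum_mul_kernel {ι : Type*} [Fintype ι] [DecidableEq ι] [Nonempty X] (i : ι)
    (w g : (ι → X) → ℝ) (hw : ∀ x, ∑ z, w (Function.update x i z) = 1)
    (hg : ∀ x z, g (Function.update x i z) = g x) :
    ∑ x, w x * g x = ∑ x, (Fintype.card X : ℝ)⁻¹ * g x := by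
  rw [sum_eq_average_update _ i, ← Finset.mul_sum]
  congr 1
  refine Finset.sum_congr rfl fun x _ => ?_
  simp [hg, ← Finset.sum_mul, hw]

/-- Causal probability kernels at the times `≥ n` do not affect the expectation of a function of
the first `n` coordinates, and may be replaced by uniform laws. -/
theorem sum_prod_kernel [Nonempty X] (w : Fin H → (Fin H → X) → ℝ)
    (hw : ∀ t x y, (∀ i ≤ t, x i = y i) → w t x = w t y)
    (hsum : ∀ t x, ∑ z, w t (Function.update x t z) = 1) (f : (Fin H → X) → ℝ) (n : ℕ)
    (hf : ∀ x y, (∀ i : Fin H, (i : ℕ) < n → x i = y i) → f x = f y) :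
    ∑ x, (∏ t, w t x) * f x =
      ∑ x, (∏ t : Fin H, if (t : ℕ) < n then w t x else (Fintype.card X : ℝ)⁻¹) * f x := by
  have key : ∀ m, n ≤ m →
      ∑ x, (∏ t : Fin H, if (t : ℕ) < m then w t x else (Fintype.card X : ℝ)⁻¹) * f x =
      ∑ x, (∏ t : Fin H, if (t : ℕ) < n then w t x else (Fintype.card X : ℝ)⁻¹) * f x := by
    intro m hm
    induction m, hm using Nat.le_induction with
    | base => rfl
    | succ m hm ih =>
      rw [← ih]
      by_cases hmH : m < H
      · let i : Fin H := ⟨m, hmH⟩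
        let g : (Fin H → X) → ℝ := fun x =>
          (∏ t ∈ Finset.univ.erase i, if (t : ℕ) < m then w t x else (Fintype.card X : ℝ)⁻¹) * f x
        have hne : ∀ t ∈ Finset.univ.erase i, (t : ℕ) ≠ m := fun t ht h =>
          (Finset.mem_erase.1 ht).1 (Fin.ext h)
        -- The kernel at time `m` is the last nontrivial factor: earlier kernels ignore coordinate
        -- `m` by causality, later factors are constant, and `f` ignores it because `n ≤ m`.
        have h1 := sum_mul_kernel i (w i) g (hsum i) fun x z => by
          refine congr_arg₂ _ (Finset.prod_congr rfl fun t ht => ?_)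
            (hf _ _ fun t ht => Function.update_of_ne (fun h => ?_) _ _)
          · split_ifs with h
            · refine hw _ _ _ fun j hj => Function.update_of_ne (fun h' => ?_) _ _
              subst h'
              exact absurd (lt_of_le_of_lt (Fin.le_def.1 hj) h) (lt_irrefl _)
            · rfl
          · subst h
            exact absurd ht (by simp [i]; omega)
        convert h1 using 2 with x _ x _
        · rw [← Finset.mul_prod_erase _ _ (Finset.mem_univ i), if_pos (by simp [i]), mul_assoc]
          congr 2
          refine Finset.prod_congr rfl fun t ht => ?_
          have := hne t ht
          exact if_congr (by omega) rfl rfl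
        · rw [← Finset.mul_prod_erase _ _ (Finset.mem_univ i), if_neg (by simp [i]), mul_assoc]
      · refine Finset.sum_congr rfl fun x _ => ?_
        congr 1
        refine Finset.prod_congr rfl fun t _ => ?_
        have := t.isLt
        rw [if_pos (by omega), if_pos (by omega)]
  rcases le_total n H with hn | hn
  · rw [← key H hn]
    simp
  · refine Finset.sum_congr rfl fun x _ => ?_
    congr 1
    refine Finset.prod_congr rfl fun t _ => ?_
    rw [if_pos (t.isLt.trans_le hn)]

end Marginalization

/-! ### Trajectory laws, the policy gradient and its constants -/

section Policy

variable {O S A : Type*} [Fintype O] [Fintype S] [Fintype A] {H d : ℕ}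
  {E : EpisodicNMDP O A H} {π : PolicyFamily d O S A H} {s₀ : S} {a₀ : A} {G M rmax : ℝ}

omit [Fintype A] in
theorem EpisodicNMDP.nonempty_obs (E : EpisodicNMDP O A H) (hH : 1 ≤ H) : Nonempty O := by
  by_contra hO
  rw [not_nonempty_iff] at hO
  have := (E.obsLaw ⟨0, hH⟩ Fin.elim0 Fin.elim0).2.2
  simp at this

omit [Fintype O] in
/-- Each policy entry has the score as its logarithmic gradient, including the entries which vanish
identically. -/
theorem isLogSmooth_policy (hG : 0 ≤ G) (hM : 0 ≤ M) (hreg : IsRegular π)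
    (hb : HasScoreHessianBounds π G M) (t : Fin H) (s' : S) (a' : A) (o : O) (s : S) (a : A) :
    IsLogSmooth (fun θ => (π θ t s' a' o).1 (s, a)) (score π t s' a' o s a) G M := by
  have hnn : ∀ θ, 0 ≤ (π θ t s' a' o).1 (s, a) := fun θ => (π θ t s' a' o).2.1 _
  by_cases hpos : ∃ η, 0 < (π η t s' a' o).1 (s, a)
  · obtain ⟨η, hη⟩ := hpos
    have hp : ∀ θ, 0 < (π θ t s' a' o).1 (s, a) := fun θ =>
      hreg.support_indep t s' a' o s a η θ hη
    refine ⟨hnn, fun θ => ?_, fun θ => hb.score_le _ _ _ _ _ _ _ (hp θ),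
      fun θ => hb.differentiable_score _ _ _ _ _ _ _ (hp θ),
      fun θ => hb.hessian_le _ _ _ _ _ _ _ (hp θ)⟩
    have hd := (hreg.differentiable t s' a' o s a θ).hasFDerivAt
    have hl := hd.log (hp θ).ne'
    rw [hasGradientAt_iff_hasFDerivAt]
    refine hd.congr_fderiv ?_
    rw [score, gradient, hl.fderiv]
    simp [smul_smul, mul_inv_cancel₀ (hp θ).ne']
  · push Not at hpos
    have h0 : ∀ θ, (π θ t s' a' o).1 (s, a) = 0 := fun θ => le_antisymm (hpos θ) (hnn θ)
    -- With the convention `Real.log 0 = 0`, the logarithm of an identically vanishing entry is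
    -- constant, so its score is zero and needs no hypothesis from `hb`.
    have hs : score π t s' a' o s a = fun _ => 0 := by
      funext θ
      simp only [score, h0, Real.log_zero]
      exact gradient_const _ _
    simp only [h0, hs]
    have := IsLogSmooth.const (V := EuclideanSpace ℝ (Fin d)) le_rfl
    exact ⟨this.1, this.2, fun _ => by simpa using hG, this.4, fun _ => by simpa using hM⟩

/-- The factor of step `t` in the probability of a trajectory. -/
noncomputable def stepProb (E : EpisodicNMDP O A H) (π : PolicyFamily d O S A H) (s₀ : S) (a₀ : A) (t : Fin H)
    (τ : Traj O S A H) (θ : EuclideanSpace ℝ (Fin d)) : ℝ :=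
  (E.obsLaw t (upTo τ.1 t t.isLt.le) (upTo τ.2.2 t t.isLt.le)).1 (τ.1 t) *
    (π θ t (prev s₀ τ.2.1 t) (prev a₀ τ.2.2 t) (τ.1 t)).1 (τ.2.1 t, τ.2.2 t)

/-- The score of step `t` of a trajectory. -/
noncomputable def stepScore (π : PolicyFamily d O S A H) (s₀ : S) (a₀ : A) (t : Fin H)
    (τ : Traj O S A H) (θ : EuclideanSpace ℝ (Fin d)) : EuclideanSpace ℝ (Fin d) :=
  score π t (prev s₀ τ.2.1 t) (prev a₀ τ.2.2 t) (τ.1 t) (τ.2.1 t) (τ.2.2 t) θ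

theorem isLogSmooth_stepProb (hG : 0 ≤ G) (hM : 0 ≤ M) (hreg : IsRegular π)
    (hb : HasScoreHessianBounds π G M) (t : Fin H) (τ : Traj O S A H) :
    IsLogSmooth (stepProb E π s₀ a₀ t τ) (stepScore π s₀ a₀ t τ) G M :=
  (isLogSmooth_policy hG hM hreg hb _ _ _ _ _ _).const_mul
    ((E.obsLaw t (upTo τ.1 t t.isLt.le) (upTo τ.2.2 t t.isLt.le)).2.1 _)

/-- The law of a trajectory played with the policy `π_θ` for the first `n` steps and drawn uniformly
afterwards. -/
noncomputable def truncProb (E : EpisodicNMDP O A H) (π : PolicyFamily d O S A H) (s₀ : S) (a₀ : A) (n : ℕ)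
    (τ : Traj O S A H) (θ : EuclideanSpace ℝ (Fin d)) : ℝ :=
  ∏ t : Fin H, if (t : ℕ) < n then stepProb E π s₀ a₀ t τ θ
    else (Fintype.card (O × S × A) : ℝ)⁻¹

/-- The sum of the scores of the first `n` steps of a trajectory. -/
noncomputable def truncScore (π : PolicyFamily d O S A H) (s₀ : S) (a₀ : A) (n : ℕ)
    (τ : Traj O S A H) (θ : EuclideanSpace ℝ (Fin d)) : EuclideanSpace ℝ (Fin d) :=
  ∑ t : Fin H, if (t : ℕ) < n then stepScore π s₀ a₀ t τ θ else 0

theorem sum_ite_lt_const {n : ℕ} (hn : n ≤ H) (c : ℝ) :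
    ∑ t : Fin H, (if (t : ℕ) < n then c else 0) = n * c := by
  rw [Fin.sum_univ_eq_sum_range (fun t => if t < n then c else 0) H, Finset.sum_ite]
  have : (Finset.range H).filter (· < n) = Finset.range n := by
    ext; simp; omega
  simp [this]

/-- Only `n` of the `H` factors depend on the parameter, which is why `n` and not `H` multiplies the
constants. -/
theorem isLogSmooth_truncProb (hG : 0 ≤ G) (hM : 0 ≤ M) (hreg : IsRegular π)
    (hb : HasScoreHessianBounds π G M) {n : ℕ} (hn : n ≤ H) (τ : Traj O S A H) :
    IsLogSmooth (truncProb E π s₀ a₀ n τ) (truncScore π s₀ a₀ n τ) (n * G) (n * M) := by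
  rw [← sum_ite_lt_const hn G, ← sum_ite_lt_const hn M]
  refine IsLogSmooth.prod Finset.univ fun t _ => ?_
  split_ifs with h
  · exact isLogSmooth_stepProb hG hM hreg hb t τ
  · exact .const (by positivity)

/-- Trajectories as sequences of triples. -/
def trajEquiv : (Fin H → O × S × A) ≃ Traj O S A H where
  toFun x := (fun i => (x i).1, fun i => (x i).2.1, fun i => (x i).2.2)
  invFun τ i := (τ.1 i, τ.2.1 i, τ.2.2 i)
  left_inv _ := rfl
  right_inv _ := rfl

theorem upTo_congr {X : Type*} {x y : Fin H → X} {n : ℕ} (hn : n ≤ H)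
    (h : ∀ i : Fin H, (i : ℕ) < n → x i = y i) : upTo x n hn = upTo y n hn :=
  funext fun i => h _ (by simp)

theorem prev_congr {X : Type*} (x₀ : X) {x y : Fin H → X} {t : Fin H}
    (h : ∀ i < t, x i = y i) : prev x₀ x t = prev x₀ y t := by
  unfold prev
  rcases Fin.eq_zero_or_eq_succ t.castSucc with h0 | ⟨j, hj⟩
  · simp [h0]
  · rw [hj]
    simp only [Matrix.cons_val_succ]
    refine h j (Fin.lt_def.2 ?_)
    have := congr_arg Fin.val hj
    simp at this
    omega

theorem stepProb_congr (t : Fin H) {x y : Fin H → O × S × A} (h : ∀ i ≤ t, x i = y i)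
    (θ : EuclideanSpace ℝ (Fin d)) :
    stepProb E π s₀ a₀ t (trajEquiv x) θ = stepProb E π s₀ a₀ t (trajEquiv y) θ := by
  simp only [stepProb, trajEquiv, Equiv.coe_fn_mk]
  rw [upTo_congr t.isLt.le (y := fun i => (y i).1) fun i hi => by rw [h i (Fin.le_def.2 hi.le)],
    upTo_congr t.isLt.le (y := fun i => (y i).2.2) fun i hi => by rw [h i (Fin.le_def.2 hi.le)],
    prev_congr s₀ (y := fun i => (y i).2.1) fun i hi => by rw [h i hi.le],
    prev_congr a₀ (y := fun i => (y i).2.2) fun i hi => by rw [h i hi.le], h t le_rfl]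

theorem sum_stepProb_update (t : Fin H) (x : Fin H → O × S × A) (θ : EuclideanSpace ℝ (Fin d)) :
    ∑ z, stepProb E π s₀ a₀ t (trajEquiv (Function.update x t z)) θ = 1 := by
  have hne : ∀ z, ∀ i < t, Function.update x t z i = x i := fun z i hi =>
    Function.update_of_ne hi.ne _ _
  have h1 : ∀ z, stepProb E π s₀ a₀ t (trajEquiv (Function.update x t z)) θ =
      (E.obsLaw t (upTo (fun i => (x i).1) t t.isLt.le) (upTo (fun i => (x i).2.2) t t.isLt.le)).1
        z.1 * (π θ t (prev s₀ (fun i => (x i).2.1) t) (prev a₀ (fun i => (x i).2.2) t) z.1).1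
          z.2 := by
    intro z
    simp only [stepProb, trajEquiv, Equiv.coe_fn_mk]
    rw [upTo_congr t.isLt.le (y := fun i => (x i).1) fun i hi => by rw [hne z i hi],
      upTo_congr t.isLt.le (y := fun i => (x i).2.2) fun i hi => by rw [hne z i hi],
      prev_congr s₀ (y := fun i => (x i).2.1) fun i hi => by rw [hne z i hi],
      prev_congr a₀ (y := fun i => (x i).2.2) fun i hi => by rw [hne z i hi]]
    simp
  simp only [h1]
  rw [Fintype.sum_prod_type]
  simp only [← Finset.mul_sum]
  have h2 : ∀ o, ∑ z, (π θ t (prev s₀ (fun i => (x i).2.1) t) (prev a₀ (fun i => (x i).2.2) t)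
    o).1 z = 1 := fun o => (π θ t _ _ o).2.2
  simp only [h2, mul_one]
  exact (E.obsLaw t _ _).2.2

/-- The expectation of a function of the first `n` steps does not depend on the later steps. -/
theorem sum_trajProb_mul (hH : 1 ≤ H) (n : ℕ) (θ : EuclideanSpace ℝ (Fin d))
    (f : Traj O S A H → ℝ)
    (hf : ∀ x y : Fin H → O × S × A, (∀ i : Fin H, (i : ℕ) < n → x i = y i) →
      f (trajEquiv x) = f (trajEquiv y)) :
    ∑ τ, trajProb E π s₀ a₀ θ τ * f τ = ∑ τ, truncProb E π s₀ a₀ n τ θ * f τ := by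
  have : Nonempty (O × S × A) := ⟨((E.nonempty_obs hH).some, s₀, a₀)⟩
  rw [← Equiv.sum_comp trajEquiv, ← Equiv.sum_comp trajEquiv]
  exact sum_prod_kernel (fun t x => stepProb E π s₀ a₀ t (trajEquiv x) θ)
    (fun t x y h => stepProb_congr t h θ) (fun t x => sum_stepProb_update t x θ)
    (fun x => f (trajEquiv x)) n hf

theorem trajProb_nonneg (θ : EuclideanSpace ℝ (Fin d)) (τ : Traj O S A H) :
    0 ≤ trajProb E π s₀ a₀ θ τ :=
  Finset.prod_nonneg fun t _ => mul_nonneg ((E.obsLaw t _ _).2.1 _) ((π θ t _ _ _).2.1 _)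

theorem truncProb_self (τ : Traj O S A H) (θ : EuclideanSpace ℝ (Fin d)) :
    truncProb E π s₀ a₀ H τ θ = trajProb E π s₀ a₀ θ τ := by
  simp [truncProb, trajProb, stepProb]

theorem sum_truncProb (hH : 1 ≤ H) (n : ℕ) (θ : EuclideanSpace ℝ (Fin d)) :
    ∑ τ, truncProb E π s₀ a₀ n τ θ = 1 := by
  have h0 : ∀ n, ∑ τ, trajProb E π s₀ a₀ θ τ = ∑ τ, truncProb E π s₀ a₀ n τ θ := fun n => by
    simpa using sum_trajProb_mul (E := E) (π := π) (s₀ := s₀) (a₀ := a₀) hH n θ (fun _ => 1)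
      fun _ _ _ => rfl
  -- All cut-offs have the same total mass, and the cut-off `0` gives the uniform law on
  -- trajectories.
  rw [← h0, h0 0]
  have : Nonempty (O × S × A) := ⟨((E.nonempty_obs hH).some, s₀, a₀)⟩
  rw [← Equiv.sum_comp trajEquiv]
  simp only [truncProb, Nat.not_lt_zero, if_false, Finset.prod_const, Finset.sum_const,
    Finset.card_univ, Fintype.card_pi_const, Fintype.card_fin, nsmul_eq_mul, Nat.cast_pow]
  rw [← mul_pow, mul_inv_cancel₀ (Nat.cast_ne_zero.2 Fintype.card_ne_zero),
    one_pow]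

theorem sum_trajProb (hH : 1 ≤ H) (θ : EuclideanSpace ℝ (Fin d)) :
    ∑ τ, trajProb E π s₀ a₀ θ τ = 1 := by
  simp only [← truncProb_self]
  exact sum_truncProb hH H θ

omit [Fintype S] [Fintype A] in
theorem rewardAt_congr (t : Fin H) {x y : Fin H → O × S × A}
    (h : ∀ i : Fin H, (i : ℕ) < t + 1 → x i = y i) :
    rewardAt E (trajEquiv x) t = rewardAt E (trajEquiv y) t := by
  simp only [rewardAt, trajEquiv, Equiv.coe_fn_mk]
  rw [upTo_congr t.isLt (y := fun i => (y i).1) fun i hi => by rw [h i hi],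
    upTo_congr t.isLt (y := fun i => (y i).2.2) fun i hi => by rw [h i hi]]

omit [Fintype O] in
theorem truncScore_congr (n : ℕ) {x y : Fin H → O × S × A}
    (h : ∀ i : Fin H, (i : ℕ) < n → x i = y i) (θ : EuclideanSpace ℝ (Fin d)) :
    truncScore π s₀ a₀ n (trajEquiv x) θ = truncScore π s₀ a₀ n (trajEquiv y) θ := by
  refine Finset.sum_congr rfl fun t _ => ?_
  split_ifs with ht
  · simp only [stepScore, trajEquiv, Equiv.coe_fn_mk]
    rw [prev_congr s₀ (y := fun i => (y i).2.1) fun i hi => by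
        rw [h i ((Fin.lt_def.1 hi).trans ht)],
      prev_congr a₀ (y := fun i => (y i).2.2) fun i hi => by
        rw [h i ((Fin.lt_def.1 hi).trans ht)], h t ht]
  · rfl

/-- Exchange the two sums over pairs `t ≤ l`: a score multiplies all later rewards exactly when a
reward multiplies all earlier scores. In this form each term depends on the first `l + 1` steps
only. -/
theorem gradEstimate_eq (θ : EuclideanSpace ℝ (Fin d)) (τ : Traj O S A H) :
    gradEstimate E π s₀ a₀ θ τ =
      ∑ l : Fin H, rewardAt E τ l • truncScore π s₀ a₀ (l + 1) τ θ := by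
  simp only [gradEstimate, rewardToGo, truncScore, Finset.sum_smul, Finset.smul_sum,
    Finset.sum_filter]
  rw [Finset.sum_comm]
  refine Finset.sum_congr rfl fun l _ => Finset.sum_congr rfl fun t _ => ?_
  by_cases h : t ≤ l
  · rw [if_pos h, if_pos (Nat.lt_succ_of_le h)]
    rfl
  · rw [if_neg h, if_neg (fun h' => h (Nat.le_of_lt_succ h')), smul_zero, zero_smul]

/-- The objective in terms of truncated laws. -/
theorem objective_eq (hH : 1 ≤ H) :
    objective E π s₀ a₀ = fun θ =>
      ∑ l : Fin H, ∑ τ, truncProb E π s₀ a₀ (l + 1) τ θ * rewardAt E τ l := by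
  funext θ
  simp only [objective, totalReturn, Finset.mul_sum]
  rw [Finset.sum_comm]
  exact Finset.sum_congr rfl fun l _ =>
    sum_trajProb_mul hH (l + 1) θ (fun τ => rewardAt E τ l) fun x y h => rewardAt_congr l h

theorem hasGradientAt_objective (hH : 1 ≤ H) (hG : 0 ≤ G) (hM : 0 ≤ M) (hreg : IsRegular π)
    (hb : HasScoreHessianBounds π G M) (θ : EuclideanSpace ℝ (Fin d)) :
    HasGradientAt (objective E π s₀ a₀) (∑ l : Fin H, ∑ τ, rewardAt E τ l •
      (truncProb E π s₀ a₀ (l + 1) τ θ • truncScore π s₀ a₀ (l + 1) τ θ)) θ := by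
  rw [objective_eq hH]
  have h1 : ∀ l : Fin H, HasGradientAt
      (fun θ => ∑ τ, truncProb E π s₀ a₀ (l + 1) τ θ * rewardAt E τ l)
      (∑ τ, rewardAt E τ l •
        (truncProb E π s₀ a₀ (l + 1) τ θ • truncScore π s₀ a₀ (l + 1) τ θ)) θ := fun l =>
    hasGradientAt_sum_mul _ (fun τ => rewardAt E τ l) fun τ _ =>
      (isLogSmooth_truncProb hG hM hreg hb l.isLt τ).hasGradientAt θ
  simpa using hasGradientAt_sum_mul Finset.univ (fun _ => (1 : ℝ)) fun l _ => h1 l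

omit [Fintype S] [Fintype A] in
theorem abs_rewardAt_le (hr : ∀ t o a, |E.reward t o a| ≤ rmax) (τ : Traj O S A H) (l : Fin H) :
    |rewardAt E τ l| ≤ rmax := hr _ _ _

theorem gradient_objective (hH : 1 ≤ H) (hG : 0 ≤ G) (hM : 0 ≤ M) (hreg : IsRegular π)
    (hb : HasScoreHessianBounds π G M) :
    gradient (objective E π s₀ a₀) = fun θ => ∑ l : Fin H, ∑ τ, rewardAt E τ l •
      (truncProb E π s₀ a₀ (l + 1) τ θ • truncScore π s₀ a₀ (l + 1) τ θ) :=
  funext fun θ => (hasGradientAt_objective hH hG hM hreg hb θ).gradient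

/-- The stochastic gradient is unbiased. -/
theorem sum_trajProb_smul_gradEstimate (hH : 1 ≤ H) (hG : 0 ≤ G) (hM : 0 ≤ M) (hreg : IsRegular π)
    (hb : HasScoreHessianBounds π G M) (θ : EuclideanSpace ℝ (Fin d)) :
    ∑ τ, trajProb E π s₀ a₀ θ τ • gradEstimate E π s₀ a₀ θ τ =
      gradient (objective E π s₀ a₀) θ := by
  rw [gradient_objective hH hG hM hreg hb]
  simp only [gradEstimate_eq, Finset.smul_sum]
  rw [Finset.sum_comm]
  refine Finset.sum_congr rfl fun l _ => ?_
  -- The marginalization lemma is for real-valued functions, so it is applied to each coordinate.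
  ext i
  have := sum_trajProb_mul (E := E) (π := π) (s₀ := s₀) (a₀ := a₀) hH (l + 1) θ
    (fun τ => rewardAt E τ l * truncScore π s₀ a₀ (l + 1) τ θ i) fun x y h => by
      rw [rewardAt_congr l h, truncScore_congr _ h]
  simp only [WithLp.ofLp_sum, Finset.sum_apply, PiLp.smul_apply, smul_eq_mul]
  rw [this]
  exact Finset.sum_congr rfl fun τ _ => by ring

theorem sum_fin_succ_mul (c : ℝ) : ∑ l : Fin H, ((l : ℕ) + 1 : ℝ) * c = H * (H + 1) / 2 * c := by
  rw [Fin.sum_univ_eq_sum_range (fun l => ((l : ℕ) + 1 : ℝ) * c) H, ← Finset.sum_mul]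
  congr 1
  induction H with
  | zero => simp
  | succ n ih => rw [Finset.sum_range_succ, ih]; push_cast; ring

/-- The reward with index `l` multiplies `l + 1` scores, and these counts add up to `H (H + 1) / 2`.
-/
theorem norm_gradEstimate_le (hG : 0 ≤ G) (hM : 0 ≤ M) (hrmax : 0 ≤ rmax)
    (hr : ∀ t o a, |E.reward t o a| ≤ rmax) (hreg : IsRegular π)
    (hb : HasScoreHessianBounds π G M) (θ : EuclideanSpace ℝ (Fin d)) (τ : Traj O S A H) :
    ‖gradEstimate E π s₀ a₀ θ τ‖ ≤ noiseConst rmax G H / 2 := by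
  rw [gradEstimate_eq]
  calc _ ≤ ∑ l : Fin H, ((l : ℕ) + 1 : ℝ) * (rmax * G) := by
        refine norm_sum_le_of_le _ fun l _ => ?_
        rw [norm_smul, Real.norm_eq_abs]
        have h1 := (isLogSmooth_truncProb (E := E) (s₀ := s₀) (a₀ := a₀) hG hM hreg hb l.isLt
          τ).norm_le θ
        refine (mul_le_mul (abs_rewardAt_le hr τ l) h1 (norm_nonneg _) hrmax).trans_eq ?_
        push_cast
        ring
    _ = _ := by rw [sum_fin_succ_mul, noiseConst]; ring

omit [Fintype O] in
theorem differentiable_truncScore (hG : 0 ≤ G) (hM : 0 ≤ M) (hreg : IsRegular π)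
    (hb : HasScoreHessianBounds π G M) (n : ℕ) (τ : Traj O S A H) :
    Differentiable ℝ (truncScore π s₀ a₀ n τ) := by
  refine Differentiable.fun_sum fun t _ => ?_
  split_ifs
  · exact (isLogSmooth_policy hG hM hreg hb _ _ _ _ _ _).differentiable
  · exact differentiable_const _

theorem continuous_gradEstimate (hG : 0 ≤ G) (hM : 0 ≤ M) (hreg : IsRegular π)
    (hb : HasScoreHessianBounds π G M) (τ : Traj O S A H) :
    Continuous fun θ => gradEstimate E π s₀ a₀ θ τ := by
  simp only [gradEstimate_eq]
  exact continuous_finsetSum _ fun l _ =>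
    (differentiable_truncScore hG hM hreg hb _ _).continuous.fun_const_smul _

theorem continuous_trajProb (hreg : IsRegular π) (τ : Traj O S A H) :
    Continuous fun θ => trajProb E π s₀ a₀ θ τ :=
  continuous_finsetProd _ fun _ _ =>
    continuous_const.mul (hreg.differentiable _ _ _ _ _ _).continuous

/-- The origin of `β`: the sums of the first `n` squares and of the first `n` integers give its `G ^
2` and `M` parts. -/
theorem sum_range_smoothConst (rmax G M : ℝ) (n : ℕ) :
    ∑ l ∈ Finset.range n, rmax * (((l + 1 : ℕ) * G) ^ 2 + (l + 1 : ℕ) * M) =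
      smoothConst rmax G M n := by
  induction n with
  | zero => simp [smoothConst]
  | succ n ih => rw [Finset.sum_range_succ, ih, smoothConst, smoothConst]; push_cast; ring

/-- Mean value inequality, with the Hessian bounded separately for each reward time. Without
truncation every reward would cost `(H G)² + H M`. -/
theorem norm_gradient_objective_sub_le (hH : 1 ≤ H) (hG : 0 ≤ G) (hM : 0 ≤ M) (hreg : IsRegular π)
    (hr : ∀ t o a, |E.reward t o a| ≤ rmax)
    (hb : HasScoreHessianBounds π G M) (θ η : EuclideanSpace ℝ (Fin d)) :
    ‖gradient (objective E π s₀ a₀) θ - gradient (objective E π s₀ a₀) η‖ ≤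
      smoothConst rmax G M H * ‖θ - η‖ := by
  have hls : ∀ (l : Fin H) τ, IsLogSmooth (truncProb E π s₀ a₀ (l + 1) τ)
      (truncScore π s₀ a₀ (l + 1) τ) ((l + 1 : ℕ) * G) ((l + 1 : ℕ) * M) := fun l τ =>
    isLogSmooth_truncProb hG hM hreg hb l.isLt τ
  have hd : ∀ l : Fin H, Differentiable ℝ fun θ => ∑ τ, rewardAt E τ l •
      (truncProb E π s₀ a₀ (l + 1) τ θ • truncScore π s₀ a₀ (l + 1) τ θ) := fun l =>
    Differentiable.fun_sum fun τ _ => ((hls l τ).differentiable_smul).fun_const_smul _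
  have hsum : ∑ l : Fin H, rmax * ((((l : ℕ) + 1 : ℕ) * G) ^ 2 + ((l : ℕ) + 1 : ℕ) * M) =
      smoothConst rmax G M H := by
    rw [Fin.sum_univ_eq_sum_range
      (fun l => rmax * (((l + 1 : ℕ) * G) ^ 2 + (l + 1 : ℕ) * M)) H]
    exact sum_range_smoothConst rmax G M H
  rw [gradient_objective hH hG hM hreg hb]
  refine Convex.norm_image_sub_le_of_norm_fderiv_le (𝕜 := ℝ)
    (fun x _ => (Differentiable.fun_sum fun l _ => hd l) x) (fun x _ => ?_) convex_univ
    (Set.mem_univ η) (Set.mem_univ θ)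
  rw [fderiv_fun_sum fun l _ => hd l x, ← hsum]
  exact norm_sum_le_of_le _ fun l _ => norm_fderiv_sum_smul_le _ (fun τ _ => hls l τ)
    (fun τ _ => abs_rewardAt_le hr τ l) (sum_truncProb hH _ x)

theorem objective_le (hH : 1 ≤ H) (hr : ∀ t o a, |E.reward t o a| ≤ rmax)
    (θ : EuclideanSpace ℝ (Fin d)) : objective E π s₀ a₀ θ ≤ H * rmax := by
  calc objective E π s₀ a₀ θ ≤ ∑ τ, trajProb E π s₀ a₀ θ τ * (H * rmax) := by
        refine Finset.sum_le_sum fun τ _ =>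
          mul_le_mul_of_nonneg_left ?_ (trajProb_nonneg θ τ)
        have : totalReturn E τ ≤ ∑ _t : Fin H, rmax :=
          Finset.sum_le_sum fun t _ => (le_abs_self _).trans (abs_rewardAt_le hr τ t)
        simpa using this
    _ = H * rmax := by rw [← Finset.sum_mul, sum_trajProb hH, one_mul]

end Policy

/-! ### Two probabilistic lemmas -/

/-- Hoeffding's lemma for a centered random variable with finitely many values. -/
theorem sum_mul_exp_le {X : Type*} [Fintype X] {p y : X → ℝ} {c : ℝ} (hp : ∀ x, 0 ≤ p x)
    (hp1 : ∑ x, p x = 1) (hy : ∀ x, |y x| ≤ c) (hmean : ∑ x, p x * y x = 0) :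
    ∑ x, p x * Real.exp (y x) ≤ Real.exp (c ^ 2 / 2) := by
  -- By convexity, `exp` lies below its chord over `[-c, c]`; the linear part vanishes in the mean.
  -- For `c = 0` the quotient is zero by convention and `y x = 0`.
  have hchord : ∀ x, Real.exp (y x) ≤ Real.cosh c + Real.sinh c / c * y x := by
    intro x
    obtain ⟨h1, h2⟩ := abs_le.1 (hy x)
    rcases ((abs_nonneg _).trans (hy x)).eq_or_lt with h0 | h0
    · have : y x = 0 := by rw [← h0] at h1 h2; linarith
      simp [← h0, this]
    · have h3 := convexOn_exp.2 (Set.mem_univ c) (Set.mem_univ (-c))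
        (show 0 ≤ (c + y x) / (2 * c) by apply div_nonneg <;> linarith)
        (show 0 ≤ (c - y x) / (2 * c) by apply div_nonneg <;> linarith)
        (by field_simp; ring)
      simp only [smul_eq_mul] at h3
      have h4 : (c + y x) / (2 * c) * c + (c - y x) / (2 * c) * -c = y x := by field_simp; ring
      rw [h4] at h3
      refine h3.trans_eq ?_
      rw [Real.cosh_eq, Real.sinh_eq]
      field_simp
      ring
  calc ∑ x, p x * Real.exp (y x)
      ≤ ∑ x, p x * (Real.cosh c + Real.sinh c / c * y x) :=
        Finset.sum_le_sum fun x _ => mul_le_mul_of_nonneg_left (hchord x) (hp x)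
    _ = (∑ x, p x) * Real.cosh c + Real.sinh c / c * ∑ x, p x * y x := by
        rw [Finset.sum_mul, Finset.mul_sum, ← Finset.sum_add_distrib]
        exact Finset.sum_congr rfl fun x _ => by ring
    _ = Real.cosh c := by rw [hp1, hmean]; ring
    _ ≤ _ := Real.cosh_le_exp_half_sq c

/-- Nonnegative random variables whose expectations have bounded partial sums are almost surely
summable. -/
theorem ae_summable_of_sum_integral_le {Ω : Type*} [MeasurableSpace Ω] {P : Measure Ω}
    {f : ℕ → Ω → ℝ} (hf : ∀ k ω, 0 ≤ f k ω) (hint : ∀ k, Integrable (f k) P) {c : ℝ}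
    (hc : ∀ n, ∑ k ∈ Finset.range n, ∫ ω, f k ω ∂P ≤ c) : ∀ᵐ ω ∂P, Summable fun k => f k ω := by
  have hmeas : ∀ k, AEMeasurable (fun ω => ENNReal.ofReal (f k ω)) P := fun k =>
    (hint k).aemeasurable.ennreal_ofReal
  have hS : Summable fun k => ∫ ω, f k ω ∂P :=
    summable_of_sum_range_le (fun k => integral_nonneg (hf k)) hc
  have h1 : ∫⁻ ω, ∑' k, ENNReal.ofReal (f k ω) ∂P ≠ ⊤ := by
    rw [lintegral_tsum hmeas]
    simp only [← ofReal_integral_eq_lintegral_ofReal (hint _) (ae_of_all _ (hf _))]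
    exact hS.tsum_ofReal_ne_top
  filter_upwards [ae_lt_top' (AEMeasurable.tsum hmeas) h1] with ω hω
  simpa [ENNReal.toReal_ofReal, hf] using ENNReal.summable_toReal hω.ne

/-! ### Stochastic gradient ascent with a bounded unbiased oracle -/

section StochasticAscent

variable {V : Type*} [NormedAddCommGroup V] [InnerProductSpace ℝ V] [CompleteSpace V]
  {X : Type*} [Fintype X]

/-- Under the laws `p θ` on a finite sample space, `g θ` is an unbiased estimate, bounded by `B`, of
the `β`-Lipschitz gradient of `J`. -/
structure IsGradientOracle (J : V → ℝ) (p : V → X → ℝ) (g : V → X → V) (β B : ℝ) : Prop where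
  differentiable : Differentiable ℝ J
  lipschitz : ∀ θ η, ‖gradient J θ - gradient J η‖ ≤ β * ‖θ - η‖
  nonneg : ∀ θ x, 0 ≤ p θ x
  sum_eq_one : ∀ θ, ∑ x, p θ x = 1
  unbiased : ∀ θ, ∑ x, p θ x • g θ x = gradient J θ
  norm_le : ∀ θ x, ‖g θ x‖ ≤ B
  continuous_prob : ∀ x, Continuous fun θ => p θ x
  continuous_est : ∀ x, Continuous fun θ => g θ x

namespace IsGradientOracle

variable {J : V → ℝ} {p : V → X → ℝ} {g : V → X → V} {β B : ℝ}

theorem norm_gradient_le (h : IsGradientOracle J p g β B) (θ : V) : ‖gradient J θ‖ ≤ B := by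
  rw [← h.unbiased]
  calc _ ≤ ∑ x, p θ x * B := norm_sum_le_of_le _ fun x _ => by
        rw [norm_smul, Real.norm_of_nonneg (h.nonneg θ x)]
        exact mul_le_mul_of_nonneg_left (h.norm_le θ x) (h.nonneg θ x)
    _ = B := by rw [← Finset.sum_mul, h.sum_eq_one, one_mul]

theorem continuous_gradient (h : IsGradientOracle J p g β B) : Continuous (gradient J) := by
  have : gradient J = fun θ => ∑ x, p θ x • g θ x := funext fun θ => (h.unbiased θ).symm
  rw [this]
  exact continuous_finsetSum _ fun x _ => (h.continuous_prob x).smul (h.continuous_est x)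

theorem sum_mul_inner (h : IsGradientOracle J p g β B) (θ : V) :
    ∑ x, p θ x * inner ℝ (gradient J θ) (g θ x) = ‖gradient J θ‖ ^ 2 := by
  rw [← real_inner_self_eq_norm_sq]
  conv_rhs => rw [← h.unbiased θ, inner_sum]
  simp only [inner_smul_right, h.unbiased]

theorem abs_inner_le (h : IsGradientOracle J p g β B) (θ : V) (x : X) :
    |inner ℝ (gradient J θ) (g θ x)| ≤ ‖gradient J θ‖ * B :=
  (abs_real_inner_le_norm _ _).trans (mul_le_mul_of_nonneg_left (h.norm_le θ x) (norm_nonneg _))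

/-- The noise of the estimate in the direction of the gradient is sub-Gaussian. -/
theorem sum_mul_exp_noise_le (h : IsGradientOracle J p g β B) (s : ℝ) (θ : V) :
    ∑ x, p θ x * Real.exp (-(s * (inner ℝ (gradient J θ) (g θ x) - ‖gradient J θ‖ ^ 2)) -
      s ^ 2 * (2 * B) ^ 2 * ‖gradient J θ‖ ^ 2 / 2) ≤ 1 := by
  -- The range of the noise is proportional to `‖gradient J θ‖`, so the compensator is a multiple of
  -- the squared gradient norm; this is what allows it to be absorbed later.
  have h1 := sum_mul_exp_le (p := p θ) (c := |s| * (‖gradient J θ‖ * (2 * B)))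
    (y := fun x => -(s * (inner ℝ (gradient J θ) (g θ x) - ‖gradient J θ‖ ^ 2)))
    (h.nonneg θ) (h.sum_eq_one θ) (fun x => ?_) ?_
  · have h2 : ∀ x, p θ x * Real.exp (-(s * (inner ℝ (gradient J θ) (g θ x) -
        ‖gradient J θ‖ ^ 2)) - s ^ 2 * (2 * B) ^ 2 * ‖gradient J θ‖ ^ 2 / 2) =
        p θ x * Real.exp (-(s * (inner ℝ (gradient J θ) (g θ x) - ‖gradient J θ‖ ^ 2))) *
        (Real.exp (s ^ 2 * (2 * B) ^ 2 * ‖gradient J θ‖ ^ 2 / 2))⁻¹ := fun x => by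
      rw [Real.exp_sub, div_eq_mul_inv, ← mul_assoc (p θ x)]
    simp only [h2]
    rw [← Finset.sum_mul, ← div_eq_mul_inv, div_le_one (Real.exp_pos _)]
    refine h1.trans_eq ?_
    rw [mul_pow, mul_pow, sq_abs]
    ring_nf
  · rw [abs_neg, abs_mul]
    refine mul_le_mul_of_nonneg_left ((abs_sub _ _).trans ?_) (abs_nonneg _)
    have h2 := h.abs_inner_le θ x
    have h3 := mul_le_mul_of_nonneg_left (h.norm_gradient_le θ) (norm_nonneg (gradient J θ))
    rw [abs_of_nonneg (sq_nonneg ‖gradient J θ‖)]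
    linarith
  · simp only [mul_neg, Finset.sum_neg_distrib, neg_eq_zero, mul_left_comm _ s]
    rw [← Finset.mul_sum]
    simp only [mul_sub, Finset.sum_sub_distrib]
    rw [h.sum_mul_inner, ← Finset.sum_mul, h.sum_eq_one]
    ring

end IsGradientOracle

variable {Ω : Type*}

/-- The σ-algebra generated by the samples `T 1, …, T (k - 1)`. -/
abbrev history (T : ℕ → Ω → X) (k : ℕ) : MeasurableSpace Ω :=
  ⨆ j ∈ Finset.Ico 1 k, MeasurableSpace.comap (T j) ⊤

omit [Fintype X] in
theorem history_monotone (T : ℕ → Ω → X) : Monotone (history T) := fun _ _ hkl =>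
  biSup_mono fun _ hj => Finset.Ico_subset_Ico_right hkl hj

omit [Fintype X] in
theorem measurable_history {T : ℕ → Ω → X} {j k : ℕ} (hj : 1 ≤ j) (hjk : j < k) :
    @Measurable Ω X (history T k) ⊤ (T j) := by
  rw [measurable_iff_comap_le]
  exact le_iSup₂_of_le j (Finset.mem_Ico.2 ⟨hj, hjk⟩) le_rfl

theorem measurable_comp_finite {W Z : Type*} [MeasurableSpace W] [MeasurableSpace Z]
    {m : MeasurableSpace Ω} {f : W → X → Z} (hf : ∀ x, Measurable fun v => f v x) {t : Ω → W}
    {S : Ω → X} (ht : Measurable[m] t) (hS : @Measurable Ω X m ⊤ S) :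
    Measurable[m] fun ω => f (t ω) (S ω) := by
  let _ : MeasurableSpace X := ⊤
  have : Measurable fun q : W × X => f q.1 q.2 := measurable_from_prod_countable_left hf
  exact this.comp (ht.prodMk hS)

/-- A run of stochastic gradient ascent with samples `T k` and iterates `θ k`. -/
structure IsAscentRun (p : V → X → ℝ) (g : V → X → V) [MeasurableSpace Ω] (P : Measure Ω)
    (θ₁ : V) (α : ℕ → ℝ) (T : ℕ → Ω → X) (θ : ℕ → Ω → V) : Prop where
  measurable : ∀ k, 1 ≤ k → ∀ x, MeasurableSet (T k ⁻¹' {x})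
  cond_law : ∀ k, 1 ≤ k → ∀ x, P⟦T k ⁻¹' {x} | history T k⟧ =ᵐ[P] fun ω => p (θ k ω) x
  init : ∀ ω, θ 1 ω = θ₁
  step : ∀ k, 1 ≤ k → ∀ ω, θ (k + 1) ω = θ k ω + α k • g (θ k ω) (T k ω)

namespace IsAscentRun

variable {J : V → ℝ} {p : V → X → ℝ} {g : V → X → V} {β B : ℝ} [mΩ : MeasurableSpace Ω]
  {P : Measure Ω} {θ₁ : V} {α : ℕ → ℝ} {T : ℕ → Ω → X} {θ : ℕ → Ω → V}

omit [CompleteSpace V] in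
theorem history_le (hr : IsAscentRun p g P θ₁ α T θ) (k : ℕ) : history T k ≤ mΩ := by
  refine iSup₂_le fun j hj => ?_
  rintro _ ⟨s, -, rfl⟩
  rw [← Set.biUnion_preimage_singleton]
  exact .biUnion s.to_countable fun x _ => hr.measurable j (Finset.mem_Ico.1 hj).1 x

variable [MeasurableSpace V] [BorelSpace V]

omit [CompleteSpace V] in
theorem measurable_iterate (hr : IsAscentRun p g P θ₁ α T θ)
    (hg : ∀ x, Continuous fun θ => g θ x) {k : ℕ} (hk : 1 ≤ k) :
    Measurable[history T k] (θ k) := by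
  induction k, hk using Nat.le_induction with
  | base => simpa only [funext hr.init] using measurable_const
  | succ k hk ih =>
    have h1 : Measurable[history T (k + 1)] (θ k) := ih.mono (history_monotone T k.le_succ) le_rfl
    simp only [funext (hr.step k hk)]
    exact measurable_comp_finite (f := fun v x => v + α k • g v x)
      (fun x => (continuous_id.add ((hg x).const_smul _)).measurable) h1
      (measurable_history hk k.lt_succ_self)

omit [CompleteSpace V] [MeasurableSpace V] [BorelSpace V] in
/-- Conditioning on the history: the sample may be integrated out. -/
theorem integral_sample [IsProbabilityMeasure P] (hr : IsAscentRun p g P θ₁ α T θ)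
    {k : ℕ} (hk : 1 ≤ k) {φ : Ω → X → ℝ}
    (hφ : ∀ x, Measurable[history T k] fun ω => φ ω x) {c : ℝ} (hc : ∀ ω x, |φ ω x| ≤ c) :
    Integrable (fun ω => φ ω (T k ω)) P ∧ Integrable (fun ω => ∑ x, p (θ k ω) x * φ ω x) P ∧
      ∫ ω, φ ω (T k ω) ∂P = ∫ ω, ∑ x, p (θ k ω) x * φ ω x ∂P := by
  classical
  have hle := hr.history_le k
  have hφm : ∀ x, Measurable fun ω => φ ω x := fun x => (hφ x).mono hle le_rfl
  have hφi : ∀ x, Integrable (fun ω => φ ω x) P := fun x =>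
    .of_bound (hφm x).aestronglyMeasurable c (ae_of_all _ fun ω => hc ω x)
  have hind : ∀ x, Integrable ((T k ⁻¹' {x}).indicator fun _ => (1 : ℝ)) P := fun x =>
    (integrable_const 1).indicator (hr.measurable k hk x)
  have hprod : ∀ x, Integrable ((fun ω => φ ω x) * (T k ⁻¹' {x}).indicator fun _ => (1 : ℝ)) P :=
    fun x => (hind x).bdd_mul (hφm x).aestronglyMeasurable (ae_of_all _ fun ω => hc ω x)
  have hpull : ∀ x, P[(fun ω => φ ω x) * (T k ⁻¹' {x}).indicator (fun _ => (1 : ℝ)) | history T k]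
      =ᵐ[P] fun ω => p (θ k ω) x * φ ω x := fun x => by
    filter_upwards [condExp_mul_of_stronglyMeasurable_left (hφ x).stronglyMeasurable (hprod x)
      (hind x), hr.cond_law k hk x] with ω h1 h2
    rw [h1, Pi.mul_apply, h2, mul_comm]
  have hpi : ∀ x, Integrable (fun ω => p (θ k ω) x * φ ω x) P := fun x =>
    integrable_condExp.congr (hpull x)
  -- Splitting over the finitely many values of the sample leaves history-measurable factors times
  -- indicators, to which the conditional law applies.
  have heq : (fun ω => φ ω (T k ω)) = fun ω =>
      ∑ x, ((fun ω => φ ω x) * (T k ⁻¹' {x}).indicator fun _ => (1 : ℝ)) ω := by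
    funext ω
    rw [Finset.sum_eq_single (T k ω)]
    · simp
    · intro x _ hx
      have : ω ∉ T k ⁻¹' {x} := fun h => hx h.symm
      simp [this]
    · simp
  refine ⟨?_, integrable_finsetSum _ fun x _ => hpi x, ?_⟩
  · rw [heq]
    exact integrable_finsetSum _ fun x _ => hprod x
  · rw [heq, integral_finsetSum _ fun x _ => hprod x, integral_finsetSum _ fun x _ => hpi x]
    exact Finset.sum_congr rfl fun x _ => by
      rw [← integral_congr_ae (hpull x), integral_condExp hle]

theorem integrable_sq_norm_gradient [IsProbabilityMeasure P] (hr : IsAscentRun p g P θ₁ α T θ)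
    (ho : IsGradientOracle J p g β B) {k : ℕ} (hk : 1 ≤ k) :
    Integrable (fun ω => ‖gradient J (θ k ω)‖ ^ 2) P := by
  have hm : Measurable (θ k) := (hr.measurable_iterate ho.continuous_est hk).mono
    (hr.history_le k) le_rfl
  refine .of_bound ((ho.continuous_gradient.norm.pow 2).measurable.comp hm).aestronglyMeasurable
    (B ^ 2) (ae_of_all _ fun ω => ?_)
  rw [Real.norm_of_nonneg (sq_nonneg _)]
  have := ho.norm_gradient_le (θ k ω)
  gcongr

omit [MeasurableSpace V] [BorelSpace V] in
/-- Telescoped ascent along a path. -/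
theorem sum_inner_le (hr : IsAscentRun p g P θ₁ α T θ) (ho : IsGradientOracle J p g β B)
    (hβ : 0 ≤ β) (ω : Ω) (n : ℕ) :
    ∑ k ∈ Finset.Icc 1 n, α k * inner ℝ (gradient J (θ k ω)) (g (θ k ω) (T k ω)) ≤
      J (θ (n + 1) ω) - J θ₁ + β * B ^ 2 / 2 * ∑ k ∈ Finset.Icc 1 n, α k ^ 2 := by
  induction n with
  | zero => simp [hr.init]
  | succ n ih =>
    rw [Finset.sum_Icc_succ_top (by omega), Finset.sum_Icc_succ_top (by omega), mul_add]
    have h1 := le_of_gradient_lipschitz ho.differentiable ho.lipschitz (θ (n + 1) ω)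
      (α (n + 1) • g (θ (n + 1) ω) (T (n + 1) ω))
    rw [← hr.step (n + 1) (by omega), inner_smul_right, norm_smul, mul_pow, Real.norm_eq_abs,
      sq_abs] at h1
    have h2 : β / 2 * (α (n + 1) ^ 2 * ‖g (θ (n + 1) ω) (T (n + 1) ω)‖ ^ 2) ≤
        β / 2 * (α (n + 1) ^ 2 * B ^ 2) := by
      have := ho.norm_le (θ (n + 1) ω) (T (n + 1) ω)
      gcongr
    linarith

/-- The ascent inequality in expectation. -/
theorem sum_integral_sq_norm_gradient_le [IsProbabilityMeasure P]
    (hr : IsAscentRun p g P θ₁ α T θ) (ho : IsGradientOracle J p g β B) (hβ : 0 ≤ β) {Js : ℝ}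
    (hJs : ∀ θ, J θ ≤ Js) (n : ℕ) :
    ∑ k ∈ Finset.Icc 1 n, α k * ∫ ω, ‖gradient J (θ k ω)‖ ^ 2 ∂P ≤
      Js - J θ₁ + β * B ^ 2 / 2 * ∑ k ∈ Finset.Icc 1 n, α k ^ 2 := by
  have h1 : ∀ k ∈ Finset.Icc 1 n,
      Integrable (fun ω => inner ℝ (gradient J (θ k ω)) (g (θ k ω) (T k ω))) P ∧
      ∫ ω, inner ℝ (gradient J (θ k ω)) (g (θ k ω) (T k ω)) ∂P =
        ∫ ω, ‖gradient J (θ k ω)‖ ^ 2 ∂P := by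
    intro k hk
    have hk1 := (Finset.mem_Icc.1 hk).1
    have := hr.integral_sample hk1 (φ := fun ω x => inner ℝ (gradient J (θ k ω)) (g (θ k ω) x))
      (c := B * B) (fun x => (ho.continuous_gradient.inner (ho.continuous_est x)).measurable.comp
        (hr.measurable_iterate ho.continuous_est hk1)) fun ω x => (ho.abs_inner_le _ _).trans <|
          mul_le_mul_of_nonneg_right (ho.norm_gradient_le _)
            ((norm_nonneg _).trans (ho.norm_gradient_le (θ k ω)))
    simp only [ho.sum_mul_inner] at this
    exact ⟨this.1, this.2.2⟩
  calc _ = ∫ ω, ∑ k ∈ Finset.Icc 1 n,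
        α k * inner ℝ (gradient J (θ k ω)) (g (θ k ω) (T k ω)) ∂P := by
        rw [integral_finsetSum _ fun k hk => (h1 k hk).1.const_mul _]
        exact Finset.sum_congr rfl fun k hk => by rw [integral_const_mul, (h1 k hk).2]
    _ ≤ ∫ _, (Js - J θ₁ + β * B ^ 2 / 2 * ∑ k ∈ Finset.Icc 1 n, α k ^ 2) ∂P := by
        refine integral_mono (integrable_finsetSum _ fun k hk => (h1 k hk).1.const_mul _)
          (integrable_const _) fun ω => ?_
        have := hr.sum_inner_le ho hβ ω n
        have := hJs (θ (n + 1) ω)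
        dsimp only
        linarith
    _ = _ := by simp

omit [CompleteSpace V] in
theorem measurable_sum_comp (hr : IsAscentRun p g P θ₁ α T θ)
    (hg : ∀ x, Continuous fun θ => g θ x) {ψ : ℕ → V → X → ℝ}
    (hψ : ∀ k x, Continuous fun v => ψ k v x) (n : ℕ) :
    Measurable[history T (n + 1)] fun ω => ∑ k ∈ Finset.Icc 1 n, ψ k (θ k ω) (T k ω) := by
  refine Finset.measurable_sum _ fun k hk => ?_
  obtain ⟨h1, h2⟩ := Finset.mem_Icc.1 hk
  exact measurable_comp_finite (fun x => (hψ k x).measurable)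
    ((hr.measurable_iterate hg h1).mono (history_monotone T (by omega)) le_rfl)
    (measurable_history h1 (by omega))

/-- An exponential supermartingale along the run. -/
theorem integral_exp_sum_le_one [IsProbabilityMeasure P] (hr : IsAscentRun p g P θ₁ α T θ)
    (ho : IsGradientOracle J p g β B) {ψ : ℕ → V → X → ℝ} {c : ℕ → ℝ}
    (hψ : ∀ k x, Continuous fun v => ψ k v x) (hc : ∀ k v x, ψ k v x ≤ c k)
    (hψ1 : ∀ k v, ∑ x, p v x * Real.exp (ψ k v x) ≤ 1) (n : ℕ) :
    Integrable (fun ω => Real.exp (∑ k ∈ Finset.Icc 1 n, ψ k (θ k ω) (T k ω))) P ∧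
      ∫ ω, Real.exp (∑ k ∈ Finset.Icc 1 n, ψ k (θ k ω) (T k ω)) ∂P ≤ 1 := by
  induction n with
  | zero => simp
  | succ n ih =>
    -- The exponential of the first `n` terms is known from the history, and integrating out the new
    -- sample contributes a factor at most one.
    obtain ⟨h1, h2, h3⟩ := hr.integral_sample n.succ_pos
      (φ := fun ω x => Real.exp (∑ k ∈ Finset.Icc 1 n, ψ k (θ k ω) (T k ω)) *
        Real.exp (ψ (n + 1) (θ (n + 1) ω) x))
      (c := Real.exp (∑ k ∈ Finset.Icc 1 n, c k) * Real.exp (c (n + 1)))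
      (fun x => (Real.measurable_exp.comp (hr.measurable_sum_comp ho.continuous_est hψ n)).mul
        (Real.measurable_exp.comp ((hψ (n + 1) x).measurable.comp
          (hr.measurable_iterate ho.continuous_est n.succ_pos))))
      (fun ω x => by
        rw [abs_of_pos (by positivity)]
        exact mul_le_mul (Real.exp_le_exp.2 (Finset.sum_le_sum fun k _ => hc k _ _))
          (Real.exp_le_exp.2 (hc _ _ _)) (Real.exp_pos _).le (Real.exp_pos _).le)
    simp only [Finset.sum_Icc_succ_top (show 1 ≤ n + 1 by omega), Real.exp_add]
    refine ⟨h1, h3.trans_le ((integral_mono h2 ih.1 fun ω => ?_).trans ih.2)⟩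
    dsimp only
    simp only [mul_left_comm (p _ _)]
    rw [← Finset.mul_sum]
    exact mul_le_of_le_one_right (Real.exp_pos _).le (hψ1 _ _)

/-- The ascent inequality with high probability. -/
theorem le_prob_sum_sq_norm_gradient_le [IsProbabilityMeasure P]
    (hr : IsAscentRun p g P θ₁ α T θ) (ho : IsGradientOracle J p g β B) (hβ : 0 ≤ β) (hB : 0 < B)
    {Js : ℝ} (hJs : ∀ θ, J θ ≤ Js) (n : ℕ) {a δ : ℝ} (ha : 0 < a)
    (hα : ∀ k ∈ Finset.Icc 1 n, 0 ≤ α k ∧ α k ≤ a) (hδ : 0 < δ) :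
    1 - δ ≤ P.real {ω | ∑ k ∈ Finset.Icc 1 n, α k * ‖gradient J (θ k ω)‖ ^ 2 ≤
      2 * (Js - J θ₁) + β * B ^ 2 * ∑ k ∈ Finset.Icc 1 n, α k ^ 2 +
        2 * (2 * B) ^ 2 * a * Real.log (1 / δ)} := by
  -- The scale is chosen so that `l * (2 * B) ^ 2 * α k ≤ 1`: the compensator in `ψ` then costs at
  -- most half of `l * α k * ‖gradient J v‖ ^ 2`.
  set l : ℝ := 1 / ((2 * B) ^ 2 * a) with hl
  have hl0 : 0 < l := by positivity
  have hlB : l * (2 * B) ^ 2 * a = 1 := by rw [hl]; field_simp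
  set ψ : ℕ → V → X → ℝ := fun k v x =>
    -((l * α k) * (inner ℝ (gradient J v) (g v x) - ‖gradient J v‖ ^ 2)) -
      (l * α k) ^ 2 * (2 * B) ^ 2 * ‖gradient J v‖ ^ 2 / 2 with hψ
  have hcont : ∀ k x, Continuous fun v => ψ k v x := fun k x => by
    have h1 := ho.continuous_gradient
    have h2 := h1.inner (𝕜 := ℝ) (ho.continuous_est x)
    simp only [hψ]
    fun_prop
  have hbd : ∀ k v x, ψ k v x ≤ |l * α k| * (2 * B ^ 2) := by
    intro k v x
    have h1 : 0 ≤ (l * α k) ^ 2 * (2 * B) ^ 2 * ‖gradient J v‖ ^ 2 / 2 := by positivity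
    have h2 := neg_le_abs ((l * α k) * (inner ℝ (gradient J v) (g v x) - ‖gradient J v‖ ^ 2))
    rw [abs_mul] at h2
    have h3 : |inner ℝ (gradient J v) (g v x) - ‖gradient J v‖ ^ 2| ≤ 2 * B ^ 2 := by
      refine (abs_sub _ _).trans ?_
      have h4 := ho.abs_inner_le v x
      have h5 := ho.norm_gradient_le v
      have h6 := norm_nonneg (gradient J v)
      rw [abs_of_nonneg (sq_nonneg ‖gradient J v‖)]
      nlinarith
    have h4 := mul_le_mul_of_nonneg_left h3 (abs_nonneg (l * α k))
    simp only [hψ]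
    linarith
  obtain ⟨hint, hle⟩ := hr.integral_exp_sum_le_one ho hcont hbd
    (fun k v => ho.sum_mul_exp_noise_le _ v) n
  set F : Ω → ℝ := fun ω => ∑ k ∈ Finset.Icc 1 n, ψ k (θ k ω) (T k ω) with hF
  have hFm : Measurable F :=
    (hr.measurable_sum_comp ho.continuous_est hcont n).mono (hr.history_le _) le_rfl
  have hmarkov := (mul_meas_ge_le_integral_of_nonneg
    (ae_of_all _ fun ω => (Real.exp_pos (F ω)).le) hint (1 / δ)).trans hle
  have hbad : P.real {ω | 1 / δ ≤ Real.exp (F ω)} ≤ δ := by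
    rwa [one_div_mul_eq_div, div_le_one hδ] at hmarkov
  have hms : MeasurableSet {ω | 1 / δ ≤ Real.exp (F ω)} :=
    measurableSet_le measurable_const (Real.measurable_exp.comp hFm)
  have hcompl := probReal_compl_eq_one_sub (μ := P) hms
  refine (show 1 - δ ≤ P.real {ω | 1 / δ ≤ Real.exp (F ω)}ᶜ by rw [hcompl]; linarith).trans
    (measureReal_mono fun ω hω => ?_)
  simp only [Set.mem_compl_iff, Set.mem_ofPred_eq, not_le] at hω ⊢
  have h1 : F ω < Real.log (1 / δ) := (Real.lt_log_iff_exp_lt (by positivity)).2 hω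
  have h2 := hr.sum_inner_le ho hβ ω n
  have h3 := hJs (θ (n + 1) ω)
  have h4 : l * ((∑ k ∈ Finset.Icc 1 n, α k * ‖gradient J (θ k ω)‖ ^ 2) / 2 -
      ∑ k ∈ Finset.Icc 1 n, α k * inner ℝ (gradient J (θ k ω)) (g (θ k ω) (T k ω))) ≤ F ω := by
    rw [hF, Finset.sum_div, ← Finset.sum_sub_distrib, Finset.mul_sum]
    refine Finset.sum_le_sum fun k hk => ?_
    obtain ⟨h5, h6⟩ := hα k hk
    have h7 : l * (2 * B) ^ 2 * α k ≤ 1 := by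
      rw [← hlB]
      gcongr
    have h8 : 0 ≤ l * α k * ‖gradient J (θ k ω)‖ ^ 2 / 2 := by positivity
    simp only [hψ]
    nlinarith [mul_le_mul_of_nonneg_right h7 h8]
  have h5 := mul_lt_mul_of_pos_left (h4.trans_lt h1) (show 0 < (2 * B) ^ 2 * a by positivity)
  rw [← mul_assoc, show (2 * B) ^ 2 * a * l = 1 by linarith, one_mul] at h5
  linarith

/-- Almost sure convergence of the gradients for Robbins-Monro stepsizes. -/
theorem ae_tendsto_norm_gradient [IsProbabilityMeasure P]
    (hr : IsAscentRun p g P θ₁ α T θ) (ho : IsGradientOracle J p g β B) (hβ : 0 < β) (hB : 0 < B)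
    {Js : ℝ} (hJs : ∀ θ, J θ ≤ Js) (hα : ∀ k, 1 ≤ k → 0 < α k)
    (hdiv : Tendsto (fun n => ∑ k ∈ Finset.Icc 1 n, α k) atTop atTop)
    (hsq : Summable fun k => α (k + 1) ^ 2) :
    ∀ᵐ ω ∂P, Tendsto (fun k => ‖gradient J (θ k ω)‖) atTop (𝓝 0) := by
  have hIcc : ∀ (f : ℕ → ℝ) n, ∑ k ∈ Finset.range n, f (k + 1) = ∑ k ∈ Finset.Icc 1 n, f k :=
    fun f n => by
      rw [Finset.range_eq_Ico, Finset.sum_Ico_add' f 0 n 1, zero_add,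
        Finset.Ico_add_one_right_eq_Icc]
  have hpos : ∀ k, 0 < α (k + 1) := fun k => hα _ k.succ_pos
  have hsum := ae_summable_of_sum_integral_le (P := P)
    (f := fun k ω => α (k + 1) * ‖gradient J (θ (k + 1) ω)‖ ^ 2)
    (c := Js - J θ₁ + β * B ^ 2 / 2 * ∑' k, α (k + 1) ^ 2)
    (fun k ω => mul_nonneg (hpos k).le (sq_nonneg _))
    (fun k => (hr.integrable_sq_norm_gradient ho k.succ_pos).const_mul _) fun n => by
      simp only [integral_const_mul]
      rw [hIcc fun k => α k * ∫ ω, ‖gradient J (θ k ω)‖ ^ 2 ∂P]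
      refine (hr.sum_integral_sq_norm_gradient_le ho hβ.le hJs n).trans ?_
      rw [← hIcc fun k => α k ^ 2]
      have := hsq.sum_le_tsum (Finset.range n) fun k _ => sq_nonneg _
      gcongr
  have hα0 : Tendsto (fun k => α (k + 1)) atTop (𝓝 0) := by
    have := (Real.continuous_sqrt.tendsto 0).comp hsq.tendsto_atTop_zero
    simpa [Function.comp_def, Real.sqrt_sq (hpos _).le] using this
  have hns : ¬ Summable fun k => α (k + 1) := by
    rw [not_summable_iff_tendsto_nat_atTop_of_nonneg fun k => (hpos k).le]
    simpa only [hIcc] using hdiv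
  filter_upwards [hsum] with ω hω
  rw [← tendsto_add_atTop_iff_nat 1]
  -- A step has length at most `α B`, and the gradient is `β`-Lipschitz.
  refine tendsto_zero_of_summable_mul_sq (c := β * B) (by positivity) hpos hα0 hns
    (fun k => norm_nonneg _) hω fun k => ?_
  have h1 := ho.lipschitz (θ (k + 1 + 1) ω) (θ (k + 1) ω)
  rw [hr.step (k + 1) k.succ_pos, add_sub_cancel_left, norm_smul,
    Real.norm_of_nonneg (hpos k).le] at h1
  have h2 := norm_sub_norm_le (gradient J (θ (k + 1) ω + α (k + 1) • g (θ (k + 1) ω)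
    (T (k + 1) ω))) (gradient J (θ (k + 1) ω))
  have h3 := mul_le_mul_of_nonneg_left (ho.norm_le (θ (k + 1) ω) (T (k + 1) ω))
    (mul_pos hβ (hpos k)).le
  rw [hr.step (k + 1) k.succ_pos]
  linarith

end IsAscentRun

end StochasticAscent

/-! ### Stepsize arithmetic and the stationary case -/

/-- The trade-off between the bias and variance terms for a stepsize capped at `1 / β`. -/
theorem le_of_min_stepsize {β x a S D Q R : ℝ} (hβ : 0 < β) (hx : 0 < x) (hD : 0 ≤ D) (hQ : 0 ≤ Q)
    (ha : a = min (1 / β) x) (h : a * S ≤ D + Q * a ^ 2 + R * a) :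
    S ≤ β * D + D / x + Q * x + R := by
  have ha0 : 0 < a := by rw [ha]; positivity
  -- The reciprocal of the minimum is the maximum of `β` and `1 / x`, hence at most their sum.
  have h1 : 1 / a ≤ β + 1 / x := by
    rcases min_choice (1 / β) x with h | h
    · rw [ha, h, one_div_one_div]
      have : 0 < 1 / x := by positivity
      linarith
    · rw [ha, h]
      linarith
  have h2 : a ≤ x := ha ▸ min_le_right _ _
  calc S = a * S / a := by field_simp
    _ ≤ (D + Q * a ^ 2 + R * a) / a := by gcongr
    _ = D * (1 / a) + Q * a + R := by field_simp
    _ ≤ D * (β + 1 / x) + Q * x + R := by gcongr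
    _ = _ := by ring

theorem sum_one_div_le_one_add_log (n : ℕ) :
    ∑ k ∈ Finset.Icc 1 n, 1 / (k : ℝ) ≤ 1 + Real.log n := by
  have := harmonic_le_one_add_log n
  simpa [harmonic_eq_sum_Icc] using this

theorem sum_mul_of_eq_const {α f : ℕ → ℝ} {K : ℕ} {a : ℝ} (hα : ∀ k ∈ Finset.Icc 1 K, α k = a) :
    ∑ k ∈ Finset.Icc 1 K, α k * f k = a * ∑ k ∈ Finset.Icc 1 K, f k := by
  rw [Finset.mul_sum]
  exact Finset.sum_congr rfl fun k hk => by rw [hα k hk]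

theorem sum_sq_of_eq_const {α : ℕ → ℝ} {K : ℕ} {a : ℝ} (hα : ∀ k ∈ Finset.Icc 1 K, α k = a) :
    ∑ k ∈ Finset.Icc 1 K, α k ^ 2 = K * a ^ 2 := by
  rw [Finset.sum_congr rfl fun k hk => by rw [hα k hk]]
  simp

variable {V : Type*} [NormedAddCommGroup V] [InnerProductSpace ℝ V] [CompleteSpace V]
  {X : Type*} [Fintype X] {Ω : Type*} [mΩ : MeasurableSpace Ω]

omit [CompleteSpace V] [Fintype X] in
-- Serves the degenerate case of zero initial gap, where the constant stepsizes of (a) and (b)(i)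
-- vanish and division by them is impossible.
theorem IsAscentRun.iterate_eq {p : V → X → ℝ} {g : V → X → V} {P : Measure Ω} {θ₁ : V} {α : ℕ → ℝ}
    {T : ℕ → Ω → X} {θ : ℕ → Ω → V} (hr : IsAscentRun p g P θ₁ α T θ) {K : ℕ}
    (hα : ∀ k ∈ Finset.Icc 1 K, α k = 0) {k : ℕ} (hk : k ∈ Finset.Icc 1 K) (ω : Ω) :
    θ k ω = θ₁ := by
  obtain ⟨h1, h2⟩ := Finset.mem_Icc.1 hk
  induction k, h1 using Nat.le_induction with
  | base => exact hr.init ω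
  | succ k hk1 ih =>
    rw [hr.step k hk1, hα k (Finset.mem_Icc.2 ⟨hk1, by omega⟩), zero_smul, add_zero,
      ih (Finset.mem_Icc.2 ⟨hk1, by omega⟩) (by omega)]

theorem gradient_eq_zero_of_forall_le {J : V → ℝ} {θ : V} (h : ∀ η, J η ≤ J θ) :
    gradient J θ = 0 := by
  have : IsLocalMax J θ := Filter.Eventually.of_forall h
  rw [gradient, this.fderiv_eq_zero, map_zero]

end ASMPG

/-! ### The main theorem -/

theorem theorem3 {O S A : Type*} [Fintype O] [Fintype S] [Fintype A]
    {H d : ℕ} (hH : 1 ≤ H)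
    (E : ASMPG.EpisodicNMDP O A H) (π : ASMPG.PolicyFamily d O S A H) (s₀ : S) (a₀ : A)
    (rmax G M : ℝ) (hrmax : 0 < rmax) (hG : 0 < G) (hM : 0 < M)
    (hreward : ∀ t o a, |E.reward t o a| ≤ rmax)
    (hreg : ASMPG.IsRegular π)
    (hbound : ASMPG.HasScoreHessianBounds π G M)
    {Ω : Type*} [MeasurableSpace Ω] (P : Measure Ω) [IsProbabilityMeasure P]
    (θ₁ : EuclideanSpace ℝ (Fin d)) (α : ℕ → ℝ)
    (T : ℕ → Ω → ASMPG.Traj O S A H) (θ : ℕ → Ω → EuclideanSpace ℝ (Fin d))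
    (hrun : ASMPG.IsRun E π s₀ a₀ P θ₁ α T θ)
    (J : EuclideanSpace ℝ (Fin d) → ℝ) (hJ : J = ASMPG.objective E π s₀ a₀)
    (Δ₁ β C : ℝ) (hΔ : Δ₁ = ASMPG.gap E π s₀ a₀ θ₁)
    (hβ : β = ASMPG.smoothConst rmax G M H) (hC : C = ASMPG.noiseConst rmax G H) :
    -- the gradient and the supremum in the claims are genuine ones
    (Differentiable ℝ J ∧ BddAbove (Set.range J)) ∧
    -- (a) in expectation, constant stepsize
    (∀ K : ℕ, 1 ≤ K →
      (∀ k ∈ Finset.Icc 1 K, α k = min (1 / β) (2 / C * √(2 * Δ₁ / (β * K)))) →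
      (∀ k ∈ Finset.Icc 1 K, Integrable (fun ω => ‖gradient J (θ k ω)‖ ^ 2) P) ∧
      1 / (K : ℝ) * ∑ k ∈ Finset.Icc 1 K, ∫ ω, ‖gradient J (θ k ω)‖ ^ 2 ∂P
        ≤ 2 * β * Δ₁ / K + C * √(β * Δ₁ / (2 * K))) ∧
    -- (b)(i) with high probability, constant stepsize
    (∀ K : ℕ, 1 ≤ K → ∀ δ : ℝ, 0 < δ → δ < 1 →
      (∀ k ∈ Finset.Icc 1 K, α k = min (1 / β) (1 / C * √(Δ₁ / (β * K)))) →
      1 - δ ≤ P.real {ω | 1 / (K : ℝ) * ∑ k ∈ Finset.Icc 1 K, ‖gradient J (θ k ω)‖ ^ 2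
        ≤ 2 * β * Δ₁ / K + 5 * C * √(β * Δ₁ / K) + 12 * C ^ 2 * Real.log (1 / δ) / K}) ∧
    -- (b)(ii) with high probability, decreasing stepsizes
    (∀ K : ℕ, 1 ≤ K → ∀ δ : ℝ, 0 < δ → δ < 1 →
      (∀ k ∈ Finset.Icc 1 K, α k = 1 / (β * √(k : ℝ))) →
      1 - δ ≤ P.real {ω | 1 / (K : ℝ) * ∑ k ∈ Finset.Icc 1 K, ‖gradient J (θ k ω)‖ ^ 2
        ≤ (2 * β * Δ₁ + 3 * C ^ 2 * (1 + Real.log K) + 12 * C ^ 2 * Real.log (1 / δ)) / √(K : ℝ)}) ∧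
    -- (c) almost surely, Robbins-Monro stepsizes
    ((∀ k, 1 ≤ k → 0 < α k) →
      Tendsto (fun n => ∑ k ∈ Finset.Icc 1 n, α k) atTop atTop →
      Summable (fun k : ℕ => α (k + 1) ^ 2) →
      ∀ᵐ ω ∂P, Tendsto (fun k => ‖gradient J (θ k ω)‖) atTop (𝓝 0)) := by
  have hH0 : (0 : ℝ) < H := by exact_mod_cast hH
  have hβ0 : 0 < β := by rw [hβ, ASMPG.smoothConst]; positivity
  have hC0 : 0 < C := by rw [hC, ASMPG.noiseConst]; positivity
  have ho : ASMPG.IsGradientOracle J (ASMPG.trajProb E π s₀ a₀) (ASMPG.gradEstimate E π s₀ a₀)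
      β (C / 2) := by
    rw [hJ, hβ, hC]
    exact ⟨fun η => (ASMPG.hasGradientAt_objective hH hG.le hM.le hreg hbound η).differentiableAt,
      ASMPG.norm_gradient_objective_sub_le hH hG.le hM.le hreg hreward hbound,
      ASMPG.trajProb_nonneg, ASMPG.sum_trajProb hH,
      ASMPG.sum_trajProb_smul_gradEstimate hH hG.le hM.le hreg hbound,
      ASMPG.norm_gradEstimate_le hG.le hM.le hrmax.le hreward hreg hbound,
      ASMPG.continuous_trajProb hreg, ASMPG.continuous_gradEstimate hG.le hM.le hreg hbound⟩
  have hr : ASMPG.IsAscentRun (ASMPG.trajProb E π s₀ a₀) (ASMPG.gradEstimate E π s₀ a₀) P θ₁ α T θ :=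
    ⟨hrun.measurable, hrun.cond_law, hrun.init, hrun.step⟩
  have hbdd : BddAbove (Set.range J) :=
    ⟨H * rmax, by rintro _ ⟨η, rfl⟩; exact hJ ▸ ASMPG.objective_le hH hreward η⟩
  have hJs : ∀ η, J η ≤ ⨆ η, J η := fun η => le_ciSup hbdd η
  have hgap : (⨆ η, J η) - J θ₁ = Δ₁ := by rw [hΔ, ASMPG.gap, hJ]
  have hΔ0 : 0 ≤ Δ₁ := by linarith [hJs θ₁]
  -- If the gap is zero, `θ₁` is a global maximizer and zero stepsizes never leave it.
  have hstat : ∀ {K : ℕ}, Δ₁ = 0 → (∀ k ∈ Finset.Icc 1 K, α k = 0) → ∀ k ∈ Finset.Icc 1 K, ∀ ω,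
      gradient J (θ k ω) = 0 := by
    intro K h0 hα k hk ω
    rw [hr.iterate_eq hα hk]
    exact ASMPG.gradient_eq_zero_of_forall_le fun η => by linarith [hJs η]
  refine ⟨⟨ho.differentiable, hbdd⟩, fun K hK hα => ⟨fun k hk =>
    hr.integrable_sq_norm_gradient ho (Finset.mem_Icc.1 hk).1, ?_⟩, fun K hK δ hδ hδ1 hα => ?_,
    fun K hK δ hδ hδ1 hα => ?_, fun hα hdiv hsq =>
    hr.ae_tendsto_norm_gradient ho hβ0 (by positivity) hJs hα hdiv hsq⟩
  · have hK0 : (0 : ℝ) < K := by exact_mod_cast hK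
    rcases hΔ0.eq_or_lt with h0 | hΔp
    · have hz : ∀ k ∈ Finset.Icc 1 K, α k = 0 := fun k hk => by
        rw [hα k hk, ← h0]; simp [hβ0.le]
      rw [Finset.sum_eq_zero fun k hk => by simp [hstat h0.symm hz k hk]]
      simp [← h0]
    set y := √(2 * Δ₁ / (β * K)) with hy
    have hy0 : 0 < y := by positivity
    have hy2 : y ^ 2 = 2 * Δ₁ / (β * K) := Real.sq_sqrt (by positivity)
    have hΔy : Δ₁ = β * K * y ^ 2 / 2 := by rw [hy2]; field_simp
    have hroot : √(β * Δ₁ / (2 * K)) = β * y / 2 := by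
      rw [Real.sqrt_eq_iff_mul_self_eq (by positivity) (by positivity), hΔy]
      field_simp
    have h1 := hr.sum_integral_sq_norm_gradient_le ho hβ0.le hJs K
    rw [hgap, ASMPG.sum_mul_of_eq_const hα, ASMPG.sum_sq_of_eq_const hα] at h1
    -- `Q` is `β * B ^ 2 / 2 * K` with `B = C / 2`. The uncapped stepsize `2 / C * y` minimizes `Δ₁
    -- / x + Q * x`: by `h3` and `h4` both terms are equal.
    have h2 := ASMPG.le_of_min_stepsize (Q := β * C ^ 2 * K / 8) (R := 0) hβ0
      (show 0 < 2 / C * y by positivity) hΔ0 (by positivity) rfl (h1.trans_eq (by ring))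
    have h3 : Δ₁ / (2 / C * y) = K * (β * C * y / 4) := by rw [hΔy]; field_simp; norm_num
    have h4 : β * C ^ 2 * K / 8 * (2 / C * y) = K * (β * C * y / 4) := by field_simp; norm_num
    rw [hroot, one_div_mul_eq_div, div_le_iff₀ hK0]
    have h5 : (2 * β * Δ₁ / K + C * (β * y / 2)) * K = 2 * β * Δ₁ + K * (β * C * y / 2) := by
      field_simp
    have h6 : 0 ≤ β * Δ₁ := by positivity
    rw [h5]
    linarith
  · have hK0 : (0 : ℝ) < K := by exact_mod_cast hK
    have hL : 0 < Real.log (1 / δ) := Real.log_pos (by rw [lt_div_iff₀ hδ]; linarith)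
    rcases hΔ0.eq_or_lt with h0 | hΔp
    · have hz : ∀ k ∈ Finset.Icc 1 K, α k = 0 := fun k hk => by
        rw [hα k hk, ← h0]; simp [hβ0.le]
      have huniv : {ω | 1 / (K : ℝ) * ∑ k ∈ Finset.Icc 1 K, ‖gradient J (θ k ω)‖ ^ 2
          ≤ 2 * β * Δ₁ / K + 5 * C * √(β * Δ₁ / K) + 12 * C ^ 2 * Real.log (1 / δ) / K} =
          Set.univ := by
        refine Set.eq_univ_of_forall fun ω => ?_
        rw [Set.mem_ofPred_eq, Finset.sum_eq_zero fun k hk => by simp [hstat h0.symm hz k hk],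
          mul_zero]
        positivity
      rw [huniv, probReal_univ]
      linarith
    set y := √(Δ₁ / (β * K)) with hy
    have hy0 : 0 < y := by positivity
    have hy2 : y ^ 2 = Δ₁ / (β * K) := Real.sq_sqrt (by positivity)
    have hΔy : Δ₁ = β * K * y ^ 2 := by rw [hy2]; field_simp
    have hroot : √(β * Δ₁ / K) = β * y := by
      rw [Real.sqrt_eq_iff_mul_self_eq (by positivity) (by positivity), hΔy]
      field_simp
    have ha : 0 < min (1 / β) (1 / C * y) := by positivity
    refine (hr.le_prob_sum_sq_norm_gradient_le ho hβ0.le (by positivity) hJs K ha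
      (fun k hk => by rw [hα k hk]; exact ⟨ha.le, le_rfl⟩) hδ).trans
      (measureReal_mono fun ω hω => ?_)
    rw [Set.mem_ofPred_eq] at hω ⊢
    rw [hgap, ASMPG.sum_mul_of_eq_const hα, ASMPG.sum_sq_of_eq_const hα] at hω
    -- The high-probability inequality doubles the gap and the quadratic term. The resulting
    -- coefficients `9 / 4` and `2` lie within the claimed `5` and `12`.
    have h2 := ASMPG.le_of_min_stepsize (Q := β * C ^ 2 * K / 4)
      (R := 2 * C ^ 2 * Real.log (1 / δ)) hβ0
      (show 0 < 1 / C * y by positivity) (D := 2 * Δ₁) (by positivity) (by positivity) rfl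
      (hω.trans_eq (by ring))
    have h3 : 2 * Δ₁ / (1 / C * y) = K * (2 * (β * C * y)) := by rw [hΔy]; field_simp
    have h4 : β * C ^ 2 * K / 4 * (1 / C * y) = K * (β * C * y / 4) := by field_simp
    rw [hroot, one_div_mul_eq_div, div_le_iff₀ hK0]
    have h5 : (2 * β * Δ₁ / K + 5 * C * (β * y) + 12 * C ^ 2 * Real.log (1 / δ) / K) * K =
        2 * β * Δ₁ + K * (5 * (β * C * y)) + 12 * (C ^ 2 * Real.log (1 / δ)) := by
      field_simp
    have h6 : 0 ≤ K * (β * C * y) := by positivity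
    have h7 : 0 ≤ C ^ 2 * Real.log (1 / δ) := by positivity
    rw [h5]
    linarith
  · have hK0 : (0 : ℝ) < K := by exact_mod_cast hK
    have hL : 0 < Real.log (1 / δ) := Real.log_pos (by rw [lt_div_iff₀ hδ]; linarith)
    have hk1 : ∀ k ∈ Finset.Icc 1 K, (1 : ℝ) ≤ k := fun k hk => by
      exact_mod_cast (Finset.mem_Icc.1 hk).1
    have hkK : ∀ k ∈ Finset.Icc 1 K, (k : ℝ) ≤ K := fun k hk => by
      exact_mod_cast (Finset.mem_Icc.1 hk).2
    refine (hr.le_prob_sum_sq_norm_gradient_le ho hβ0.le (by positivity) hJs K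
      (show 0 < 1 / β by positivity) (fun k hk => ?_) hδ).trans (measureReal_mono fun ω hω => ?_)
    · rw [hα k hk]
      refine ⟨by positivity, ?_⟩
      have : 1 ≤ √(k : ℝ) := Real.one_le_sqrt.2 (hk1 k hk)
      gcongr
      exact le_mul_of_one_le_right hβ0.le this
    rw [Set.mem_ofPred_eq] at hω ⊢
    -- The squared stepsizes form a harmonic sum, the source of the logarithm.
    have hsq : ∑ k ∈ Finset.Icc 1 K, α k ^ 2 ≤ 1 / β ^ 2 * (1 + Real.log K) := by
      refine le_trans (le_of_eq ?_) (mul_le_mul_of_nonneg_left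
        (ASMPG.sum_one_div_le_one_add_log K) (by positivity))
      rw [Finset.mul_sum]
      refine Finset.sum_congr rfl fun k hk => ?_
      rw [hα k hk, div_pow, mul_pow, Real.sq_sqrt (by positivity)]
      ring
    -- The last stepsize is the smallest, so it bounds all weights from below.
    have hlow : 1 / (β * √(K : ℝ)) * ∑ k ∈ Finset.Icc 1 K, ‖gradient J (θ k ω)‖ ^ 2 ≤
        ∑ k ∈ Finset.Icc 1 K, α k * ‖gradient J (θ k ω)‖ ^ 2 := by
      rw [Finset.mul_sum]
      refine Finset.sum_le_sum fun k hk => ?_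
      rw [hα k hk]
      have h1 := hkK k hk
      have h2 : 0 < √(k : ℝ) := Real.sqrt_pos.2 (by linarith [hk1 k hk])
      gcongr
    have hlog : 0 ≤ Real.log K := Real.log_nonneg (by exact_mod_cast hK)
    have h1 : β * (C / 2) ^ 2 * ∑ k ∈ Finset.Icc 1 K, α k ^ 2 ≤
        β * (C / 2) ^ 2 * (1 / β ^ 2 * (1 + Real.log K)) := by gcongr
    rw [hgap] at hω
    have h2 := mul_le_mul_of_nonneg_left ((hlow.trans hω).trans
      (add_le_add_left (add_le_add_right h1 _) _)) hβ0.le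
    have hs0 : 0 < √(K : ℝ) := Real.sqrt_pos.2 hK0
    have h3 : β * (1 / (β * √(K : ℝ)) * ∑ k ∈ Finset.Icc 1 K, ‖gradient J (θ k ω)‖ ^ 2) =
        (1 / (K : ℝ) * ∑ k ∈ Finset.Icc 1 K, ‖gradient J (θ k ω)‖ ^ 2) * √(K : ℝ) := by
      field_simp
      rw [Real.sq_sqrt hK0.le, mul_comm]
    have h4 : β * (2 * Δ₁ + β * (C / 2) ^ 2 * (1 / β ^ 2 * (1 + Real.log K)) +
        2 * (2 * (C / 2)) ^ 2 * (1 / β) * Real.log (1 / δ)) =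
        2 * β * Δ₁ + C ^ 2 * (1 + Real.log K) / 4 + 2 * (C ^ 2 * Real.log (1 / δ)) := by
      field_simp
      ring
    rw [h3, h4] at h2
    rw [le_div_iff₀ hs0]
    have h5 : 0 ≤ C ^ 2 * (1 + Real.log K) := by positivity
    have h6 : 0 ≤ C ^ 2 * Real.log (1 / δ) := by positivity
    linarith
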